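/- Let $\nu$ be a Borel probability measure on $\mathbb{R}$ with $\int y^2\,d\nu(y)<\infty$, let $\beta>0$, and let $\mu=\nu^{\otimes\mathbb{N}}$. For $\mathbf h=(h_i)_{i\ge1}\in\mathbb{R}^{\mathbb{N}}$ and $n\ge 1$ let $P_{n,\beta}^{\mathbf h}$ be the probability measure on $\{-1,+1\}^n$ with $$P_{n,\beta}^{\mathbf h}(\sigma)=\frac1{Z_{n,\beta}^{\mathbf h}}\exp\Big(\frac{\beta}{2n}S_n(\sigma)^2+\beta\sum_{i=1}^n h_i\sigma_i\Big),\qquad S_n(\sigma)=\sum_{i=1}^n\sigma_i,$$ where $Z_{n,\beta}^{\mathbf h}$ is the normalizing constant. Put $$G(x)=\frac{\beta}{2}x^2-\int_{\mathbb{R}}\ln\cosh[\beta(x+y)]\,d\nu(y).$$ Let $m\in\mathbb{R}$ be a (local or global) minimum of $G$ of type $k\in\{1,2,\dots\}$ and strength $\lambda>0$, i.e. $G(x)=G(m)+\frac{\lambda}{(2k)!}(x-m)^{2k}+\mathcal{O}((x-m)^{2k+1})$ as $x\to m$. Let $h(m)=G(m)-\inf_{w\in\mathbb{R}}G(w)$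 be its height and $b(m)=\inf\{|y-m| : G(y)<G(m)\}\in(0,\infty]$ its broadness (with $\inf\emptyset=\infty$), and assume $$\beta>\frac{2h(m)}{b(m)^2}$$ (the right-hand side being $0$ if $b(m)=\infty$). Then there exists $A=A(m)>0$ such that for $\mu$-almost every $\mathbf h$ the following holds: for all $0<a<A$ and all $1-\frac{1}{2(2k-1)}<\alpha<1$, the sequence of measures $$P_n:=P_{n,\beta}^{\mathbf h}\Big(\frac{S_n-nm}{n^{\alpha}}\in\bullet\ \Big|\ \frac{S_n}{n}\in[m-a,m+a]\Big)$$ (defined for all sufficiently large $n$) satisfies a moderate deviations principle with speed $a_n=n^{1-2k(1-\alpha)}$ and rate function $$I(x)=\begin{cases}\dfrac{x^2}{2\sigma^2},\ \ \sigma^2=\lambda^{-1}-\beta^{-1}, & k=1,\\[2mm] \dfrac{\lambda x^{2k}}{(2k)!}, & k\ge2;\end{cases}$$ that is, $I$ is lower semicontinuous with compact level sets $\{I\le c\}$, $c\in\mathbb{R}$, and for every Borel set $C\subseteq\mathbb{R}$ $$-\inf_{x\in C^\circ}I(x)\le\liminf_{n\to\infty}\frac1{a_n}\ln P_n(C)\le\limsup_{n\to\infty}\frac1{a_n}\ln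 P_n(C)\le-\inf_{x\in\overline C}I(x).$$ -/

import Mathlib

open MeasureTheory ProbabilityTheory Filter Topology Asymptotics
open scoped ENNReal

namespace RFCW

noncomputable section

/-- Spin configurations: elements of `{-1, +1}ⁿ`. -/
abbrev Config (n : ℕ) : Type := Fin n → ({-1, 1} : Finset ℤ)

/-- Total magnetization `S_n(σ) = ∑ σ_i`. -/
def magnetization {n : ℕ} (σ : Config n) : ℝ := ∑ i, ((σ i : ℤ) : ℝ)

/-- Boltzmann weight `exp (β / (2 n) (∑ σ_i)² + β ∑ h_i σ_i)`; the field is indexed from `0`. -/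
def weight (β : ℝ) (h : ℕ → ℝ) {n : ℕ} (σ : Config n) : ℝ :=
  Real.exp (β / (2 * n) * magnetization σ ^ 2 + β * ∑ i : Fin n, h i * ((σ i : ℤ) : ℝ))

/-- Partition function. -/
def partitionFunction (β : ℝ) (h : ℕ → ℝ) (n : ℕ) : ℝ := ∑ σ : Config n, weight β h σ

/-- Gibbs measure `P_{n,β}^h` on `{-1, +1}ⁿ`, for a realization `h` of the external field. -/
def gibbs (β : ℝ) (h : ℕ → ℝ) (n : ℕ) : Measure (Config n) :=
  ∑ σ : Config n, ENNReal.ofReal (weight β h σ / partitionFunction β h n) • Measure.dirac σ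

/-- Law of the field: the `ℕ`-fold product of the marginal distribution `ν`. -/
def fieldLaw (ν : Measure ℝ) : Measure (ℕ → ℝ) := Measure.infinitePi fun _ : ℕ => ν

/-- `G(x) = (β / 2) x² - ∫ ln cosh (β (x + y)) dν(y)`. -/
def G (β : ℝ) (ν : Measure ℝ) (x : ℝ) : ℝ :=
  β / 2 * x ^ 2 - ∫ y, Real.log (Real.cosh (β * (x + y))) ∂ν

/-- `m` is a (local or global) minimum of `g` of type `k` and strength `lam`. -/
structure IsMinimumOfType (g : ℝ → ℝ) (m : ℝ) (k : ℕ) (lam : ℝ) : Prop where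
  isLocalMin : IsLocalMin g m
  one_le : 1 ≤ k
  strength_pos : 0 < lam
  expansion : (fun x => g x - (g m + lam / (2 * k).factorial * (x - m) ^ (2 * k)))
    =O[𝓝 m] fun x => (x - m) ^ (2 * k + 1)

/-- Height of `m`: `g(m) - inf g`. -/
def height (g : ℝ → ℝ) (m : ℝ) : ℝ := g m - ⨅ w, g w

/-- Broadness of `m`: the infimum of `|y - m|` over all `y` with `g(y) < g(m)`; it is `∞` if there
is no such `y`, that is, if `m` is a global minimum. -/
def broadness (g : ℝ → ℝ) (m : ℝ) : ℝ≥0∞ := ⨅ (y : ℝ) (_ : g y < g m), ENNReal.ofReal |y - m|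

/-- Large (or moderate) deviations principle on `ℝ` with speed `a` and good rate function `I`.
The logarithm takes the value `-∞` at `0`, and the infimum over the empty set is `+∞`. -/
structure SatisfiesLDP (P : ℕ → Measure ℝ) (a : ℕ → ℝ) (I : ℝ → EReal) : Prop where
  lowerSemicontinuous : LowerSemicontinuous I
  isCompact_level : ∀ c : ℝ, IsCompact {x | I x ≤ (c : EReal)}
  lower_bound : ∀ C : Set ℝ, MeasurableSet C →
    -(⨅ x ∈ interior C, I x) ≤ liminf (fun n => ENNReal.log (P n C) / (a n : EReal)) atTop
  upper_bound : ∀ C : Set ℝ, MeasurableSet C →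
    limsup (fun n => ENNReal.log (P n C) / (a n : EReal)) atTop ≤ -(⨅ x ∈ closure C, I x)

/-- Law of `(S_n - n m) / n^α` under `P_{n,β}^h` conditioned on `S_n / n ∈ [m - r, m + r]`. -/
def conditionedLaw (β : ℝ) (h : ℕ → ℝ) (m r α : ℝ) (n : ℕ) : Measure ℝ :=
  (cond (gibbs β h n) {σ | magnetization σ / n ∈ Set.Icc (m - r) (m + r)}).map
    fun σ => (magnetization σ - n * m) / (n : ℝ) ^ α

/-- `x² / (2 σ²)` with `σ² = λ⁻¹ - β⁻¹` if `k = 1`, and `λ x^{2k} / (2k)!` otherwise. -/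
def rateFunction (k : ℕ) (lam β x : ℝ) : ℝ :=
  if k = 1 then x ^ 2 / (2 * (lam⁻¹ - β⁻¹)) else lam * x ^ (2 * k) / (2 * k).factorial

end

end RFCW

namespace RFCW

noncomputable section

/-! Let G_n be the empirical version of G. Completing the square at an arbitrary x writes each
Boltzmann weight as 2^n exp(-n G_n(x) + nβ(S_n/n - x)²/2) times a product probability (`weight_eq`).
The point x is free and may depend on the magnetization.

At S_n/n = m + u, take x = m + cu, where c makes the exponent stationary to leading order: β(1 - c)
+ 2κ₁c = 0, with κ₁ the quadratic coefficient of G at m. So c = 1 if k ≥ 2, and c = β/(β - λ) if k =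
1, where λ < β by `strength_lt`. For upper bounds, the product probability is at most 1 and S_n
takes at most 2n + 1 values (`weightOf_le`). For lower bounds, one tilt is fixed and a Chernoff
bound shows that it concentrates at the wanted point (`eventually_tiltOf_le`). Near m both give the
exponent -n(G_n(m + cu) - G_n(m)) + nβ(1 - c)²u²/2, up to the factor 2^n exp(-n G_n(m)), which
cancels under conditioning.

It remains to replace G_n by G. As log cosh is 1-Lipschitz, Hoeffding's inequality on a grid and
Borel-Cantelli bound the error in increments from m, almost surely, by O(|u|√(log n / n) + 1/n)
(`ae_eventually_increment_close`). Multiplied by n at u of order n^(α-1), this is o(a_n) because (2k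
- 1)(1 - α) < 1/2, which is the assumption on α. The leading term of G then has order a_n, and for k
= 1 the square turns λ/2 into 1/(2σ²). -/

/-! ### Completing the square: tilted product measures -/

/-- The quenched finite-volume analogue of `G`. -/
def empiricalG (β : ℝ) (h : ℕ → ℝ) (n : ℕ) (x : ℝ) : ℝ :=
  β / 2 * x ^ 2 - (∑ i : Fin n, Real.log (Real.cosh (β * (x + h i)))) / n

/-- Product measure on configurations under which spin `i` feels the field `x + h i`. -/
def tilt (β : ℝ) (h : ℕ → ℝ) (x : ℝ) {n : ℕ} (σ : Config n) : ℝ :=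
  ∏ i : Fin n, Real.exp (β * (x + h i) * ((σ i : ℤ) : ℝ)) / (2 * Real.cosh (β * (x + h i)))

theorem tilt_pos (β : ℝ) (h : ℕ → ℝ) (x : ℝ) {n : ℕ} (σ : Config n) : 0 < tilt β h x σ :=
  Finset.prod_pos fun _ _ => div_pos (Real.exp_pos _) (by positivity)

theorem sum_tilt (β : ℝ) (h : ℕ → ℝ) (x : ℝ) (n : ℕ) : ∑ σ : Config n, tilt β h x σ = 1 := by
  have key : ∀ i : Fin n, ∑ s : ({-1, 1} : Finset ℤ),
      Real.exp (β * (x + h i) * ((s : ℤ) : ℝ)) / (2 * Real.cosh (β * (x + h i))) = 1 := by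
    intro i
    rw [Finset.sum_coe_sort ({-1, 1} : Finset ℤ) (fun s : ℤ =>
      Real.exp (β * (x + h i) * (s : ℝ)) / (2 * Real.cosh (β * (x + h i))))]
    rw [Finset.sum_pair (by norm_num), ← add_div, Real.cosh_eq]
    have : (0 : ℝ) < Real.exp (β * (x + h i)) + Real.exp (-(β * (x + h i))) := by positivity
    rw [div_eq_one_iff_eq (by positivity)]
    push_cast
    rw [mul_neg_one, mul_one]
    ring
  unfold tilt
  rw [← Fintype.prod_sum (fun (i : Fin n) (s : ({-1, 1} : Finset ℤ)) =>
      Real.exp (β * (x + h i) * ((s : ℤ) : ℝ)) / (2 * Real.cosh (β * (x + h i))))]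
  exact Finset.prod_eq_one fun i _ => key i

theorem weight_pos (β : ℝ) (h : ℕ → ℝ) {n : ℕ} (σ : Config n) : 0 < weight β h σ :=
  Real.exp_pos _

/-- Completing the square in the Boltzmann weight around an arbitrary magnetization `x`. -/
theorem weight_eq (β : ℝ) (h : ℕ → ℝ) {n : ℕ} (hn : n ≠ 0) (x : ℝ) (σ : Config n) :
    weight β h σ = 2 ^ n * Real.exp (-(n * empiricalG β h n x)
      + n * (β / 2) * (magnetization σ / n - x) ^ 2) * tilt β h x σ := by
  have hn' : (n : ℝ) ≠ 0 := by exact_mod_cast hn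
  have htilt : (2 : ℝ) ^ n * tilt β h x σ
      = Real.exp (β * x * magnetization σ + β * ∑ i : Fin n, h i * ((σ i : ℤ) : ℝ)
        - ∑ i : Fin n, Real.log (Real.cosh (β * (x + h i)))) := by
    unfold tilt magnetization
    have h2 : (2 : ℝ) ^ n = ∏ _i : Fin n, (2 : ℝ) := by simp
    rw [h2, ← Finset.prod_mul_distrib, Finset.mul_sum, Finset.mul_sum, ← Finset.sum_add_distrib,
      ← Finset.sum_sub_distrib, Real.exp_sum]
    refine Finset.prod_congr rfl fun i _ => ?_
    rw [Real.exp_sub, Real.exp_log (Real.cosh_pos _)]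
    have : Real.cosh (β * (x + h i)) ≠ 0 := (Real.cosh_pos _).ne'
    rw [show β * x * ((σ i : ℤ) : ℝ) + β * (h i * ((σ i : ℤ) : ℝ))
      = β * (x + h i) * ((σ i : ℤ) : ℝ) by ring]
    field_simp
  rw [mul_right_comm, htilt, ← Real.exp_add, weight]
  congr 1
  unfold empiricalG
  field_simp
  ring

theorem magnetization_eq_intCast {n : ℕ} (σ : Config n) :
    ∃ s ∈ Finset.Icc (-(n : ℤ)) n, magnetization σ = s := by
  refine ⟨∑ i, (σ i : ℤ), ?_, by simp [magnetization]⟩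
  have h1 : ∀ i, |((σ i : ℤ))| ≤ 1 := by
    intro i
    have := (σ i).2
    simp only [Finset.mem_insert, Finset.mem_singleton] at this
    rcases this with h | h <;> rw [h] <;> simp
  have : |∑ i, (σ i : ℤ)| ≤ n := by
    refine (Finset.abs_sum_le_sum_abs _ _).trans ?_
    refine (Finset.sum_le_sum fun i _ => h1 i).trans ?_
    simp
  rw [Finset.mem_Icc]
  exact abs_le.mp this

open Classical in
/-- Total Boltzmann weight of the configurations whose magnetization per spin lies in `T`. -/
def weightOf (β : ℝ) (h : ℕ → ℝ) (n : ℕ) (T : Set ℝ) : ℝ :=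
  ∑ σ : Config n with magnetization σ / n ∈ T, weight β h σ

theorem weightOf_mono (β : ℝ) (h : ℕ → ℝ) (n : ℕ) {T T' : Set ℝ} (hT : T ⊆ T') :
    weightOf β h n T ≤ weightOf β h n T' := by
  classical
  refine Finset.sum_le_sum_of_subset_of_nonneg ?_ fun σ _ _ => (weight_pos β h σ).le
  intro σ hσ
  simp only [Finset.mem_filter, Finset.mem_univ, true_and] at hσ ⊢
  exact hT hσ

/-- On each level set of the magnetization the tilt can be chosen separately, through `f`, because
its total mass is 1. The only price is the number of levels. -/
theorem weightOf_le (β : ℝ) (h : ℕ → ℝ) {n : ℕ} (hn : n ≠ 0) (T : Set ℝ) (f : ℝ → ℝ) (b : ℝ)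
    (hb : ∀ y ∈ T, -(n * empiricalG β h n (f y)) + n * (β / 2) * (y - f y) ^ 2 ≤ b) :
    weightOf β h n T ≤ (2 * n + 1) * (2 ^ n * Real.exp b) := by
  classical
  have hmaps : ∀ σ ∈ (Finset.univ.filter fun σ : Config n => magnetization σ / n ∈ T),
      magnetization σ ∈ (Finset.Icc (-(n : ℤ)) n).image (fun s : ℤ => (s : ℝ)) := by
    intro σ _
    obtain ⟨s, hs, h1⟩ := magnetization_eq_intCast σ
    exact Finset.mem_image.mpr ⟨s, hs, h1.symm⟩
  rw [weightOf, ← Finset.sum_fiberwise_of_maps_to hmaps]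
  have hbound : ∀ s ∈ (Finset.Icc (-(n : ℤ)) n).image (fun s : ℤ => (s : ℝ)),
      ∑ σ ∈ (Finset.univ.filter fun σ : Config n => magnetization σ / n ∈ T)
        with magnetization σ = s, weight β h σ ≤ 2 ^ n * Real.exp b := by
    intro s _
    calc _ ≤ ∑ σ ∈ (Finset.univ.filter fun σ : Config n => magnetization σ / n ∈ T)
        with magnetization σ = s, 2 ^ n * Real.exp b * tilt β h (f (s / n)) σ := by
          refine Finset.sum_le_sum fun σ hσ => ?_
          simp only [Finset.mem_filter, Finset.mem_univ, true_and] at hσ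
          rw [weight_eq β h hn (f (s / n)) σ, hσ.2]
          have := hb (s / n) (hσ.2 ▸ hσ.1)
          have ht := tilt_pos β h (f (s / n)) σ
          gcongr
      _ ≤ ∑ σ : Config n, 2 ^ n * Real.exp b * tilt β h (f (s / n)) σ := by
          refine Finset.sum_le_sum_of_subset_of_nonneg (Finset.subset_univ _) fun σ _ _ => ?_
          have ht := tilt_pos β h (f (s / n)) σ
          positivity
      _ = 2 ^ n * Real.exp b := by rw [← Finset.mul_sum, sum_tilt, mul_one]
  refine (Finset.sum_le_card_nsmul _ _ _ hbound).trans ?_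
  rw [nsmul_eq_mul]
  gcongr
  calc (((Finset.Icc (-(n : ℤ)) n).image (fun s : ℤ => (s : ℝ))).card : ℝ)
      ≤ ((Finset.Icc (-(n : ℤ)) n).card : ℝ) := by exact_mod_cast Finset.card_image_le
    _ = 2 * n + 1 := by
      rw [Int.card_Icc]
      have : ((n : ℤ) + 1 - -(n : ℤ)).toNat = 2 * n + 1 := by omega
      rw [this]; push_cast; ring

open Classical in
/-- Probability under the tilted product measure that the magnetization per spin lies in `T`. -/
def tiltOf (β : ℝ) (h : ℕ → ℝ) (n : ℕ) (x : ℝ) (T : Set ℝ) : ℝ :=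
  ∑ σ : Config n with magnetization σ / n ∈ T, tilt β h x σ

theorem one_le_tiltOf_add {β : ℝ} {h : ℕ → ℝ} {n : ℕ} {x : ℝ} {T T₁ T₂ : Set ℝ}
    (hT : T ∪ (T₁ ∪ T₂) = Set.univ) :
    1 ≤ tiltOf β h n x T + (tiltOf β h n x T₁ + tiltOf β h n x T₂) := by
  classical
  rw [← sum_tilt β h x n]
  unfold tiltOf
  rw [Finset.sum_filter, Finset.sum_filter, Finset.sum_filter, ← Finset.sum_add_distrib,
    ← Finset.sum_add_distrib]
  refine Finset.sum_le_sum fun σ _ => ?_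
  have ht := (tilt_pos β h x σ).le
  have : magnetization σ / n ∈ T ∪ (T₁ ∪ T₂) := hT ▸ Set.mem_univ _
  rcases this with h1 | h1 | h1 <;> simp only [h1, if_true] <;> split_ifs <;> linarith

/-- Chernoff's method: comparing `weight_eq` at `x` and at `x'` gives the density of one tilt with
respect to the other as a function of the magnetization alone. -/
theorem tiltOf_le (β : ℝ) (h : ℕ → ℝ) {n : ℕ} (hn : n ≠ 0) (x x' : ℝ) (T : Set ℝ) (b : ℝ)
    (hb : ∀ y ∈ T, n * (empiricalG β h n x - empiricalG β h n x')
      + n * (β / 2) * ((y - x') ^ 2 - (y - x) ^ 2) ≤ b) :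
    tiltOf β h n x T ≤ Real.exp b := by
  classical
  calc tiltOf β h n x T ≤ ∑ σ : Config n with magnetization σ / n ∈ T,
        Real.exp b * tilt β h x' σ := by
        refine Finset.sum_le_sum fun σ hσ => ?_
        simp only [Finset.mem_filter, Finset.mem_univ, true_and] at hσ
        have h1 := (weight_eq β h hn x σ).symm.trans (weight_eq β h hn x' σ)
        have h2 : tilt β h x σ = Real.exp (n * (empiricalG β h n x - empiricalG β h n x')
            + n * (β / 2) * ((magnetization σ / n - x') ^ 2 - (magnetization σ / n - x) ^ 2))
            * tilt β h x' σ := by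
          rw [mul_assoc (2 ^ n), mul_assoc (2 ^ n)] at h1
          replace h1 := mul_left_cancel₀ (by positivity) h1
          have e : n * (empiricalG β h n x - empiricalG β h n x')
              + n * (β / 2) * ((magnetization σ / n - x') ^ 2 - (magnetization σ / n - x) ^ 2)
              = (-(n * empiricalG β h n x') + n * (β / 2) * (magnetization σ / n - x') ^ 2)
              - (-(n * empiricalG β h n x) + n * (β / 2) * (magnetization σ / n - x) ^ 2) := by
            ring
          rw [e, Real.exp_sub, div_mul_eq_mul_div, eq_div_iff (Real.exp_pos _).ne', ← h1, mul_comm]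
        rw [h2]
        have ht := (tilt_pos β h x' σ).le
        have := hb _ hσ
        gcongr
    _ ≤ ∑ σ : Config n, Real.exp b * tilt β h x' σ := by
        refine Finset.sum_le_sum_of_subset_of_nonneg (Finset.subset_univ _) fun σ _ _ => ?_
        have ht := tilt_pos β h x' σ
        positivity
    _ = Real.exp b := by rw [← Finset.mul_sum, sum_tilt, mul_one]

theorem le_weightOf (β : ℝ) (h : ℕ → ℝ) {n : ℕ} (hn : n ≠ 0) (T : Set ℝ) (x b : ℝ)
    (hb : ∀ y ∈ T, b ≤ -(n * empiricalG β h n x) + n * (β / 2) * (y - x) ^ 2) :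
    2 ^ n * Real.exp b * tiltOf β h n x T ≤ weightOf β h n T := by
  classical
  rw [tiltOf, weightOf, Finset.mul_sum]
  refine Finset.sum_le_sum fun σ hσ => ?_
  simp only [Finset.mem_filter, Finset.mem_univ, true_and] at hσ
  rw [weight_eq β h hn x σ]
  have ht := (tilt_pos β h x σ).le
  have := hb _ hσ
  gcongr

/-! ### Almost sure concentration of the empirical increments -/

/-- Each of the two exponentials in cosh grows by at most a factor exp |a - b|. -/
theorem log_cosh_sub_le (a b : ℝ) :
    Real.log (Real.cosh a) - Real.log (Real.cosh b) ≤ |a - b| := by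
  rw [sub_le_iff_le_add, Real.log_le_iff_le_exp (Real.cosh_pos _), Real.exp_add,
    Real.exp_log (Real.cosh_pos _)]
  have h1 : Real.exp (a - b) ≤ Real.exp |a - b| := Real.exp_le_exp.mpr (le_abs_self _)
  have h2 : Real.exp (-(a - b)) ≤ Real.exp |a - b| := Real.exp_le_exp.mpr (neg_le_abs _)
  have e1 : Real.exp a = Real.exp (a - b) * Real.exp b := by rw [← Real.exp_add]; ring_nf
  have e2 : Real.exp (-a) = Real.exp (-(a - b)) * Real.exp (-b) := by
    rw [← Real.exp_add]; ring_nf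
  rw [Real.cosh_eq, Real.cosh_eq, e1, e2]
  nlinarith [Real.exp_pos b, Real.exp_pos (-b),
    mul_le_mul_of_nonneg_right h1 (Real.exp_pos b).le,
    mul_le_mul_of_nonneg_right h2 (Real.exp_pos (-b)).le]

theorem abs_log_cosh_sub_le (a b : ℝ) :
    |Real.log (Real.cosh a) - Real.log (Real.cosh b)| ≤ |a - b| := by
  rw [abs_le]
  have h1 := log_cosh_sub_le a b
  have h2 := log_cosh_sub_le b a
  rw [abs_sub_comm] at h2
  constructor <;> linarith

theorem continuous_log_cosh : Continuous fun x : ℝ => Real.log (Real.cosh x) :=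
  Real.continuous_cosh.log fun x => (Real.cosh_pos x).ne'

theorem integrable_log_cosh {ν : Measure ℝ} [IsProbabilityMeasure ν]
    (hν : Integrable (fun y : ℝ => y ^ 2) ν) (β x : ℝ) :
    Integrable (fun y => Real.log (Real.cosh (β * (x + y)))) ν := by
  have hy : Integrable (fun y : ℝ => y) ν :=
    ((memLp_two_iff_integrable_sq measurable_id.aestronglyMeasurable).mpr hν).integrable one_le_two
  have hb : Integrable (fun y : ℝ => β * (x + y)) ν := ((integrable_const x).add hy).const_mul β
  refine hb.mono (continuous_log_cosh.comp (by fun_prop)).aestronglyMeasurable ?_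
  refine Eventually.of_forall fun y => ?_
  simpa using abs_log_cosh_sub_le (β * (x + y)) 0

/-- Two-sided Hoeffding bound at logarithmic scale for bounded functions of the fields. -/
theorem fieldLaw_abs_sum_ge_le (ν : Measure ℝ) [IsProbabilityMeasure ν] {f : ℝ → ℝ}
    (hf : Measurable f) {B : ℝ} (hB : 0 < B) (hfB : ∀ y, |f y| ≤ B) {n : ℕ} (hn : n ≠ 0) :
    (fieldLaw ν).real {h | B * √(6 * n * Real.log n)
      ≤ |∑ i ∈ Finset.range n, (f (h i) - ∫ y, f y ∂ν)|} ≤ 2 * ((n : ℝ) ^ 3)⁻¹ := by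
  have : IsProbabilityMeasure (fieldLaw ν) := by unfold fieldLaw; infer_instance
  have hn' : (0 : ℝ) < n := by positivity
  have hn1 : (1 : ℝ) ≤ n := by exact_mod_cast Nat.one_le_iff_ne_zero.mpr hn
  have hlog : 0 ≤ Real.log n := Real.log_nonneg hn1
  have main : ∀ g : ℝ → ℝ, Measurable g → (∀ y, |g y| ≤ B) →
      (fieldLaw ν).real {h | B * √(6 * n * Real.log n)
        ≤ ∑ i ∈ Finset.range n, (g (h i) - ∫ y, g y ∂ν)} ≤ ((n : ℝ) ^ 3)⁻¹ := by
    intro g hg hgB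
    have hsub : HasSubgaussianMGF (fun y => g y - ∫ y, g y ∂ν) ((‖B - -B‖₊ / 2) ^ 2) ν :=
      hasSubgaussianMGF_of_mem_Icc hg.aemeasurable
        (Eventually.of_forall fun y => abs_le.mp (hgB y))
    have hsub' : ∀ i : ℕ, HasSubgaussianMGF (fun h : ℕ → ℝ => g (h i) - ∫ y, g y ∂ν)
        ((‖B - -B‖₊ / 2) ^ 2) (fieldLaw ν) := by
      intro i
      have hmap : (fieldLaw ν).map (fun h : ℕ → ℝ => h i) = ν :=
        Measure.infinitePi_map_eval (fun _ : ℕ => ν) i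
      exact HasSubgaussianMGF.of_map (Y := fun h : ℕ → ℝ => h i)
        (measurable_pi_apply i).aemeasurable (by rw [hmap]; exact hsub)
    have hind : iIndepFun (fun (i : ℕ) (h : ℕ → ℝ) => g (h i) - ∫ y, g y ∂ν) (fieldLaw ν) :=
      iIndepFun_infinitePi (P := fun _ : ℕ => ν) (X := fun _ y => g y - ∫ y, g y ∂ν)
        fun _ => hg.sub_const _
    have key := HasSubgaussianMGF.measure_sum_range_ge_le_of_iIndepFun hind (n := n)
      (fun i _ => hsub' i) (ε := B * √(6 * n * Real.log n)) (by positivity)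
    refine key.trans (le_of_eq ?_)
    have hc : (((‖B - -B‖₊ / 2) ^ 2 : NNReal) : ℝ) = B ^ 2 := by
      push_cast
      rw [Real.norm_eq_abs, div_pow, sq_abs]
      ring
    rw [hc, mul_pow, Real.sq_sqrt (by positivity)]
    -- The 6 in the threshold is chosen to give n⁻³, still summable after a union bound over 2n + 1
    -- grid points.
    have : -(B ^ 2 * (6 * n * Real.log n)) / (2 * n * B ^ 2) = -(3 * Real.log n) := by
      field_simp
      ring
    rw [this, Real.exp_neg, show (3 : ℝ) * Real.log n = ((3 : ℕ) : ℝ) * Real.log n by norm_num,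
      Real.exp_nat_mul, Real.exp_log hn']
  have h1 := main f hf hfB
  have h2 := main (fun y => -f y) hf.neg (fun y => by rw [abs_neg]; exact hfB y)
  have hsum : ∀ h : ℕ → ℝ, ∑ i ∈ Finset.range n, (-f (h i) - ∫ y, -f y ∂ν)
      = -∑ i ∈ Finset.range n, (f (h i) - ∫ y, f y ∂ν) := by
    intro h
    rw [← Finset.sum_neg_distrib, integral_neg]
    exact Finset.sum_congr rfl fun i _ => by ring
  simp only [hsum] at h2
  calc (fieldLaw ν).real {h | B * √(6 * n * Real.log n)
        ≤ |∑ i ∈ Finset.range n, (f (h i) - ∫ y, f y ∂ν)|}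
      ≤ (fieldLaw ν).real ({h | B * √(6 * n * Real.log n)
        ≤ ∑ i ∈ Finset.range n, (f (h i) - ∫ y, f y ∂ν)} ∪ {h | B * √(6 * n * Real.log n)
        ≤ -∑ i ∈ Finset.range n, (f (h i) - ∫ y, f y ∂ν)}) :=
        measureReal_mono fun h hh => by
          simp only [Set.mem_union, Set.mem_ofPred_eq] at hh ⊢
          exact le_abs.mp hh
    _ ≤ _ := measureReal_union_le _ _
    _ ≤ 2 * ((n : ℝ) ^ 3)⁻¹ := by linarith

/-- Fluctuation of the quenched increments around their mean. -/
theorem abs_increment_sub_eq {ν : Measure ℝ} [IsProbabilityMeasure ν]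
    (hν : Integrable (fun y : ℝ => y ^ 2) ν) (β m u : ℝ) (h : ℕ → ℝ) {n : ℕ} (hn : n ≠ 0) :
    |(empiricalG β h n (m + u) - empiricalG β h n m) - (G β ν (m + u) - G β ν m)|
      = |∑ i ∈ Finset.range n, ((Real.log (Real.cosh (β * (m + u + h i)))
          - Real.log (Real.cosh (β * (m + h i)))) - ∫ y, (Real.log (Real.cosh (β * (m + u + y)))
          - Real.log (Real.cosh (β * (m + y)))) ∂ν)| / n := by
  have hn' : (0 : ℝ) < n := by positivity
  conv_rhs => rw [← abs_of_pos hn', ← abs_div]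
  rw [← abs_neg]
  congr 1
  rw [integral_sub (integrable_log_cosh hν β _) (integrable_log_cosh hν β _),
    Finset.sum_sub_distrib, Finset.sum_sub_distrib, Finset.sum_const, Finset.card_range,
    nsmul_eq_mul, Finset.sum_range, Finset.sum_range]
  unfold empiricalG G
  field_simp
  ring

/-- Passage from grid points to all u: the empirical mean and the integral of log cosh are each
β-Lipschitz, and the quadratic terms cancel. -/
theorem abs_increment_mean_sub_le {β : ℝ} (hβ : 0 < β) {ν : Measure ℝ} [IsProbabilityMeasure ν]
    (hν : Integrable (fun y : ℝ => y ^ 2) ν) (m u u' : ℝ) (h : ℕ → ℝ) {n : ℕ} (hn : n ≠ 0) :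
    |(empiricalG β h n (m + u) - empiricalG β h n m) - (G β ν (m + u) - G β ν m)|
      ≤ |(empiricalG β h n (m + u') - empiricalG β h n m) - (G β ν (m + u') - G β ν m)|
        + 2 * β * |u - u'| := by
  have hn' : (0 : ℝ) < n := by positivity
  have hlip : ∀ y, |Real.log (Real.cosh (β * (m + u + y)))
      - Real.log (Real.cosh (β * (m + u' + y)))| ≤ β * |u - u'| := by
    intro y
    refine (abs_log_cosh_sub_le _ _).trans (le_of_eq ?_)
    rw [show β * (m + u + y) - β * (m + u' + y) = β * (u - u') by ring, abs_mul, abs_of_pos hβ]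
  have hint : |∫ y, (Real.log (Real.cosh (β * (m + u + y)))
      - Real.log (Real.cosh (β * (m + u' + y)))) ∂ν| ≤ β * |u - u'| := by
    have := norm_integral_le_of_norm_le_const (μ := ν) (C := β * |u - u'|)
      (f := fun y => Real.log (Real.cosh (β * (m + u + y)))
        - Real.log (Real.cosh (β * (m + u' + y)))) (Eventually.of_forall hlip)
    simpa using this
  rw [integral_sub (integrable_log_cosh hν β _) (integrable_log_cosh hν β _)] at hint
  have hsum : |(∑ i : Fin n, Real.log (Real.cosh (β * (m + u + h i)))) / n
      - (∑ i : Fin n, Real.log (Real.cosh (β * (m + u' + h i)))) / n| ≤ β * |u - u'| := by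
    rw [← sub_div, ← Finset.sum_sub_distrib, abs_div, abs_of_pos hn', div_le_iff₀ hn']
    refine (Finset.abs_sum_le_sum_abs _ _).trans ?_
    refine (Finset.sum_le_sum fun (i : Fin n) _ => hlip (h i)).trans (le_of_eq ?_)
    simp [mul_comm]
  set p := (empiricalG β h n (m + u) - empiricalG β h n m) - (G β ν (m + u) - G β ν m) with hp
  set q := (empiricalG β h n (m + u') - empiricalG β h n m) - (G β ν (m + u') - G β ν m) with hq
  have hpq : p - q = ((∫ y, Real.log (Real.cosh (β * (m + u + y))) ∂ν)
      - ∫ y, Real.log (Real.cosh (β * (m + u' + y))) ∂ν)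
      - ((∑ i : Fin n, Real.log (Real.cosh (β * (m + u + h i)))) / n
      - (∑ i : Fin n, Real.log (Real.cosh (β * (m + u' + h i)))) / n) := by
    rw [hp, hq]
    unfold empiricalG G
    ring
  have h1 : |p| ≤ |q| + |p - q| := by
    have := abs_add_le q (p - q)
    rwa [add_sub_cancel] at this
  have h2 := abs_sub ((∫ y, Real.log (Real.cosh (β * (m + u + y))) ∂ν)
      - ∫ y, Real.log (Real.cosh (β * (m + u' + y))) ∂ν)
      ((∑ i : Fin n, Real.log (Real.cosh (β * (m + u + h i)))) / n
      - (∑ i : Fin n, Real.log (Real.cosh (β * (m + u' + h i)))) / n)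
  rw [← hpq] at h2
  linarith

theorem exists_grid_point {n : ℕ} (hn : n ≠ 0) {u : ℝ} (hu : |u| ≤ 1) :
    ∃ j ∈ Finset.Icc (-(n : ℤ)) n, |u - j / n| ≤ 1 / n := by
  have hn' : (0 : ℝ) < n := by positivity
  obtain ⟨h1, h2⟩ := abs_le.mp hu
  refine ⟨⌊u * n⌋, ?_, ?_⟩
  · rw [Finset.mem_Icc]
    constructor
    · rw [Int.le_floor]; push_cast; nlinarith
    · have : (⌊u * n⌋ : ℝ) ≤ n := (Int.floor_le _).trans (by nlinarith)
      exact_mod_cast this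
  · have e : u - (⌊u * n⌋ : ℝ) / n = (u * n - ⌊u * n⌋) / n := by field_simp
    rw [e, abs_div, abs_of_pos hn', abs_of_nonneg (sub_nonneg.mpr (Int.floor_le _))]
    have := Int.lt_floor_add_one (u * n)
    gcongr
    linarith

/-- Almost surely, the quenched increments around `m` are uniformly close to those of `G`. -/
theorem ae_eventually_increment_close {β : ℝ} (hβ : 0 < β) {ν : Measure ℝ}
    [IsProbabilityMeasure ν] (hν : Integrable (fun y : ℝ => y ^ 2) ν) (m : ℝ) :
    ∃ K : ℝ, 0 < K ∧ ∀ᵐ h ∂(fieldLaw ν), ∀ᶠ n : ℕ in atTop, ∀ u : ℝ, |u| ≤ 1 →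
      |(empiricalG β h n (m + u) - empiricalG β h n m) - (G β ν (m + u) - G β ν m)|
        ≤ K * (|u| * √(Real.log n / n) + 1 / n) := by
  have : IsProbabilityMeasure (fieldLaw ν) := by unfold fieldLaw; infer_instance
  let X : ℝ → ℝ → ℝ := fun u y => Real.log (Real.cosh (β * (m + u + y)))
      - Real.log (Real.cosh (β * (m + y)))
  have hXm : ∀ u, Measurable (X u) := fun u =>
    ((continuous_log_cosh.comp (by fun_prop)).sub
      (continuous_log_cosh.comp (by fun_prop))).measurable
  have hXb : ∀ u y, |X u y| ≤ β * |u| := by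
    intro u y
    refine (abs_log_cosh_sub_le _ _).trans (le_of_eq ?_)
    rw [show β * (m + u + y) - β * (m + y) = β * u by ring, abs_mul, abs_of_pos hβ]
  -- The extra 1/n keeps the Hoeffding bound positive at j = 0; it only adds to the O(1/n) error.
  let E : ℕ → ℤ → Set (ℕ → ℝ) := fun n j =>
    {h | (β * (|(j : ℝ) / n| + 1 / n)) * √(6 * n * Real.log n)
      ≤ |∑ i ∈ Finset.range n, (X (j / n) (h i) - ∫ y, X (j / n) y ∂ν)|}
  let F : ℕ → Set (ℕ → ℝ) := fun n => ⋃ j ∈ Finset.Icc (-(n : ℤ)) n, E n j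
  have hF : ∀ n : ℕ, n ≠ 0 → (fieldLaw ν).real (F n) ≤ 6 * ((n : ℝ) ^ 2)⁻¹ := by
    intro n hn
    have hn' : (0 : ℝ) < n := by positivity
    have hn1 : (1 : ℝ) ≤ n := by exact_mod_cast Nat.one_le_iff_ne_zero.mpr hn
    calc (fieldLaw ν).real (F n) ≤ ∑ j ∈ Finset.Icc (-(n : ℤ)) n, (fieldLaw ν).real (E n j) :=
          measureReal_biUnion_finset_le _ _
      _ ≤ ∑ j ∈ Finset.Icc (-(n : ℤ)) n, 2 * ((n : ℝ) ^ 3)⁻¹ := by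
          refine Finset.sum_le_sum fun j _ => ?_
          refine fieldLaw_abs_sum_ge_le ν (hXm _) (by positivity) (fun y => ?_) hn
          refine (hXb _ _).trans ?_
          have : (0 : ℝ) ≤ 1 / n := by positivity
          gcongr
          linarith
      _ = (2 * n + 1) * (2 * ((n : ℝ) ^ 3)⁻¹) := by
          rw [Finset.sum_const, Int.card_Icc, nsmul_eq_mul]
          have : ((n : ℤ) + 1 - -(n : ℤ)).toNat = 2 * n + 1 := by omega
          rw [this]; push_cast; ring
      _ ≤ (3 * n) * (2 * ((n : ℝ) ^ 3)⁻¹) := by gcongr; linarith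
      _ = 6 * ((n : ℝ) ^ 2)⁻¹ := by field_simp; norm_num
  -- The index is shifted because the estimate `hF` excludes n = 0.
  have hsum : ∑' n, fieldLaw ν (F (n + 1)) ≠ ∞ := by
    have hs : Summable fun n : ℕ => 6 * (((n + 1 : ℕ) : ℝ) ^ 2)⁻¹ :=
      ((summable_nat_add_iff 1).mpr (Real.summable_nat_pow_inv.mpr one_lt_two)).mul_left 6
    refine ne_top_of_le_ne_top hs.tsum_ofReal_ne_top (ENNReal.tsum_le_tsum fun n => ?_)
    rw [← ofReal_measureReal (measure_ne_top _ _)]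
    exact ENNReal.ofReal_le_ofReal (hF (n + 1) n.succ_ne_zero)
  -- Here 8 = 6 + 2: the 1/n terms from the widened threshold and from rounding to the grid.
  refine ⟨β * 8, by positivity, ?_⟩
  filter_upwards [ae_eventually_notMem hsum] with h hh
  have hh' : ∀ᶠ n in atTop, h ∉ F n := by
    rw [eventually_atTop] at hh ⊢
    obtain ⟨N, hN⟩ := hh
    refine ⟨N + 1, fun n hn => ?_⟩
    obtain ⟨l, rfl⟩ : ∃ l, n = l + 1 := ⟨n - 1, by omega⟩
    exact hN l (by omega)
  filter_upwards [hh', eventually_ge_atTop 1] with n hnF hn1 u hu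
  have hn : n ≠ 0 := by omega
  have hn' : (0 : ℝ) < n := by positivity
  obtain ⟨j, hj, hju⟩ := exists_grid_point hn hu
  have hE : h ∉ E n j := fun hmem => hnF (Set.mem_biUnion hj hmem)
  simp only [E, X, Set.mem_ofPred_eq, not_le] at hE
  refine (abs_increment_mean_sub_le hβ hν m u (j / n) h hn).trans ?_
  rw [abs_increment_sub_eq hν β m (j / n) h hn]
  have hr : √(6 * n * Real.log n) / n ≤ 3 * √(Real.log n / n) := by
    have e : 6 * n * Real.log n = (n : ℝ) ^ 2 * (6 * (Real.log n / n)) := by field_simp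
    have h6 : √6 ≤ 3 := by
      rw [Real.sqrt_le_left (by norm_num)]; norm_num
    rw [e, Real.sqrt_mul (by positivity), Real.sqrt_sq hn'.le, Real.sqrt_mul (by norm_num),
      mul_div_cancel_left₀ _ hn'.ne']
    gcongr
  have hr1 : √(Real.log n / n) ≤ 1 := by
    rw [Real.sqrt_le_left zero_le_one, one_pow, div_le_one hn']
    exact (Real.log_le_sub_one_of_pos hn').trans (by linarith)
  have hj2 : |(j : ℝ) / n| ≤ |u| + 1 / n := by
    have := abs_sub_abs_le_abs_sub ((j : ℝ) / n) u
    rw [abs_sub_comm] at this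
    linarith
  set r := √(Real.log n / n)
  have hr0 : 0 ≤ r := Real.sqrt_nonneg _
  set d : ℝ := 1 / n
  have hd : 0 ≤ d := by positivity
  calc _ ≤ (β * (|(j : ℝ) / n| + d)) * √(6 * n * Real.log n) / n + 2 * β * |u - j / n| := by
        gcongr
    _ = (β * (|(j : ℝ) / n| + d)) * (√(6 * n * Real.log n) / n) + 2 * β * |u - j / n| := by ring
    _ ≤ (β * ((|u| + d) + d)) * (3 * r) + 2 * β * d := by gcongr
    _ = 3 * β * (|u| * r) + 6 * β * (d * r) + 2 * β * d := by ring
    _ ≤ 3 * β * (|u| * r) + 6 * β * (d * 1) + 2 * β * d := by gcongr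
    _ ≤ β * 8 * (|u| * r + d) := by nlinarith [mul_nonneg (abs_nonneg u) hr0]

/-! ### Curvature of G -/

/-- The quadratic coefficient of `G` at any point is strictly smaller than `β / 2`. -/
theorem exists_symm_increment_le {β : ℝ} (hβ : 0 < β) {ν : Measure ℝ}
    [IsProbabilityMeasure ν] (hν : Integrable (fun y : ℝ => y ^ 2) ν) (m : ℝ) :
    ∃ q : ℝ, 0 < q ∧ ∀ᶠ u : ℝ in 𝓝 0,
      (G β ν (m + u) - G β ν m) + (G β ν (m - u) - G β ν m) ≤ (β - q) * u ^ 2 := by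
  have hsech_int : Integrable (fun y => (Real.cosh (β * (m + y)) ^ 2)⁻¹) ν := by
    refine Integrable.of_bound (C := 1) ?_ ?_
    · refine Continuous.aestronglyMeasurable ?_
      refine Continuous.inv₀ (by fun_prop) fun y => ?_
      have := Real.cosh_pos (β * (m + y))
      positivity
    · refine Eventually.of_forall fun y => ?_
      have := Real.one_le_cosh (β * (m + y))
      rw [Real.norm_of_nonneg (by positivity)]
      exact inv_le_one_of_one_le₀ (one_le_pow₀ this)
  have hsech : 0 < ∫ y, (Real.cosh (β * (m + y)) ^ 2)⁻¹ ∂ν := by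
    rw [integral_pos_iff_support_of_nonneg (fun y => by positivity) hsech_int]
    have : Function.support (fun y => (Real.cosh (β * (m + y)) ^ 2)⁻¹) = Set.univ := by
      ext y
      have := Real.cosh_pos (β * (m + y))
      simp [this.ne']
    rw [this]
    simp
  -- Formally G'' = β - β²∫ sech²; half of the last term is given up in the bound log(1 + s) ≥ s/2,
  -- valid for 0 ≤ s ≤ 1.
  refine ⟨β ^ 2 / 2 * ∫ y, (Real.cosh (β * (m + y)) ^ 2)⁻¹ ∂ν, by positivity, ?_⟩
  have hsinh : ∀ᶠ u : ℝ in 𝓝 0, Real.sinh (β * u) ^ 2 < 1 := by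
    have hc : ContinuousAt (fun u : ℝ => Real.sinh (β * u) ^ 2) 0 := by fun_prop
    exact hc.eventually_lt continuousAt_const (by simp)
  filter_upwards [hsinh] with u hu
  have hptw : ∀ y, (β * u) ^ 2 / 2 * (Real.cosh (β * (m + y)) ^ 2)⁻¹
      ≤ Real.log (Real.cosh (β * (m + u + y))) + Real.log (Real.cosh (β * (m - u + y)))
        - 2 * Real.log (Real.cosh (β * (m + y))) := by
    intro y
    set b := β * (m + y) with hb
    have hcb := Real.cosh_pos b
    have hcb1 := Real.one_le_cosh b
    have e1 : β * (m + u + y) = b + β * u := by rw [hb]; ring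
    have e2 : β * (m - u + y) = b - β * u := by rw [hb]; ring
    rw [e1, e2]
    set t := β * u with ht
    set s := Real.sinh t ^ 2 * (Real.cosh b ^ 2)⁻¹ with hs
    have hs0 : 0 ≤ s := by positivity
    have hs1 : s ≤ 1 := by
      rw [hs]
      exact mul_le_one₀ hu.le (by positivity) (inv_le_one_of_one_le₀ (one_le_pow₀ hcb1))
    -- This identity turns the second difference of log cosh into log(1 + s) without any
    -- differentiation.
    have hprod : Real.cosh (b + t) * Real.cosh (b - t) = Real.cosh b ^ 2 * (1 + s) := by
      rw [hs, mul_add, mul_one, mul_comm (Real.sinh t ^ 2), mul_inv_cancel_left₀ (by positivity),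
        Real.cosh_add, Real.cosh_sub]
      have h1 := Real.cosh_sq b
      have h2 := Real.cosh_sq t
      linear_combination (Real.cosh b ^ 2) * h2 + (Real.sinh t ^ 2) * h1
    have hlog : Real.log (Real.cosh (b + t)) + Real.log (Real.cosh (b - t))
        - 2 * Real.log (Real.cosh b) = Real.log (1 + s) := by
      rw [← Real.log_mul (Real.cosh_pos _).ne' (Real.cosh_pos _).ne', hprod,
        Real.log_mul (by positivity) (by positivity), Real.log_pow]
      push_cast
      ring
    rw [hlog]
    have hl : s / 2 ≤ Real.log (1 + s) := by
      have h1 := Real.one_sub_inv_le_log_of_pos (show 0 < 1 + s by linarith)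
      refine le_trans ?_ h1
      have : 1 - (1 + s)⁻¹ = s / (1 + s) := by field_simp; ring
      rw [this]
      gcongr
      linarith
    refine le_trans ?_ hl
    have hsin : t ^ 2 ≤ Real.sinh t ^ 2 := by
      rw [sq_le_sq, Real.abs_sinh]
      exact Real.self_le_sinh_iff.mpr (abs_nonneg t)
    rw [hs]
    have : 0 ≤ (Real.cosh b ^ 2)⁻¹ := by positivity
    nlinarith
  have hi := integrable_log_cosh hν β
  have hint := integral_mono (hsech_int.const_mul ((β * u) ^ 2 / 2))
    (((hi (m + u)).add (hi (m - u))).sub ((hi m).const_mul 2)) hptw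
  rw [integral_const_mul] at hint
  have e : ∫ y, (Real.log (Real.cosh (β * (m + u + y))) + Real.log (Real.cosh (β * (m - u + y)))
        - 2 * Real.log (Real.cosh (β * (m + y)))) ∂ν
      = (∫ y, Real.log (Real.cosh (β * (m + u + y))) ∂ν)
        + (∫ y, Real.log (Real.cosh (β * (m - u + y))) ∂ν)
        - 2 * ∫ y, Real.log (Real.cosh (β * (m + y))) ∂ν := by
    have hadd : Integrable (fun y => Real.log (Real.cosh (β * (m + u + y)))
        + Real.log (Real.cosh (β * (m - u + y)))) ν := (hi (m + u)).add (hi (m - u))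
    rw [integral_sub hadd ((hi m).const_mul 2),
      integral_add (hi (m + u)) (hi (m - u)), integral_const_mul]
  have hint' := hint.trans_eq e
  unfold G
  nlinarith

/-! ### Scales and exponents -/

/-- Admissible exponents of moderate deviations for a minimum of type `k`. -/
structure ModerateScale (k : ℕ) (α : ℝ) : Prop where
  one_le : 1 ≤ k
  lt : 1 - 1 / (2 * (2 * (k : ℝ) - 1)) < α
  lt_one : α < 1

/-- Spatial scale `n ^ (α - 1)` of the magnetization per spin. -/
def scale (α : ℝ) (n : ℕ) : ℝ := (n : ℝ) ^ (α - 1)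

/-- Speed `n ^ (1 - 2 k (1 - α))`. -/
def speed (k : ℕ) (α : ℝ) (n : ℕ) : ℝ := (n : ℝ) ^ (1 - 2 * (k : ℝ) * (1 - α))

theorem scale_pos (α : ℝ) {n : ℕ} (hn : n ≠ 0) : 0 < scale α n :=
  Real.rpow_pos_of_pos (by positivity) _

theorem speed_pos (k : ℕ) (α : ℝ) {n : ℕ} (hn : n ≠ 0) : 0 < speed k α n :=
  Real.rpow_pos_of_pos (by positivity) _

theorem speed_eq (k : ℕ) (α : ℝ) {n : ℕ} (hn : n ≠ 0) :
    speed k α n = n * scale α n ^ (2 * k) := by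
  have hn' : (0 : ℝ) < n := by positivity
  rw [speed, scale, ← Real.rpow_mul_natCast hn'.le]
  nth_rewrite 2 [← Real.rpow_one (n : ℝ)]
  rw [← Real.rpow_add hn']
  congr 1
  push_cast
  ring

namespace ModerateScale

variable {k : ℕ} {α : ℝ}

theorem mul_lt (H : ModerateScale k α) : (2 * (k : ℝ) - 1) * (1 - α) < 1 / 2 := by
  have hk : (1 : ℝ) ≤ k := by exact_mod_cast H.one_le
  have h1 : 1 - α < 1 / (2 * (2 * (k : ℝ) - 1)) := by linarith [H.lt]
  rw [lt_div_iff₀ (by linarith)] at h1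
  linarith

theorem half_lt (H : ModerateScale k α) : 1 / 2 < α := by
  have hk : (1 : ℝ) ≤ k := by exact_mod_cast H.one_le
  nlinarith [H.mul_lt, H.lt_one]

theorem speed_exponent_pos (H : ModerateScale k α) : 0 < 1 - 2 * (k : ℝ) * (1 - α) := by
  nlinarith [H.mul_lt, H.half_lt]

theorem tendsto_scale (H : ModerateScale k α) : Tendsto (scale α) atTop (𝓝 0) := by
  have h1 := (tendsto_rpow_neg_atTop (sub_pos.mpr H.lt_one)).comp
    (tendsto_natCast_atTop_atTop (R := ℝ))
  refine h1.congr fun n => ?_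
  simp [scale]

theorem tendsto_speed (H : ModerateScale k α) : Tendsto (speed k α) atTop atTop :=
  (tendsto_rpow_atTop H.speed_exponent_pos).comp tendsto_natCast_atTop_atTop

/-- This product has exponent 2α - 1 and is the rate at which a tilted product measure concentrates
on the moderate scale. -/
theorem tendsto_mul_scale_sq (H : ModerateScale k α) :
    Tendsto (fun n : ℕ => n * scale α n ^ 2) atTop atTop := by
  have h1 : 0 < 2 * α - 1 := by linarith [H.half_lt]
  refine ((tendsto_rpow_atTop h1).comp (tendsto_natCast_atTop_atTop (R := ℝ))).congr' ?_
  filter_upwards [eventually_ge_atTop 1] with n hn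
  have h := speed_eq 1 α (n := n) (by omega)
  rw [mul_one] at h
  rw [← h, speed]
  simp only [Function.comp]
  congr 1
  push_cast
  ring

theorem eventually_log_le (H : ModerateScale k α) {η : ℝ} (hη : 0 < η) :
    ∀ᶠ n : ℕ in atTop, Real.log (2 * n + 1) ≤ η * speed k α n := by
  have h1 := (isLittleO_log_rpow_atTop H.speed_exponent_pos).bound (half_pos hη)
  have h2 := (tendsto_natCast_atTop_atTop (R := ℝ)).eventually h1
  filter_upwards [h2, eventually_ge_atTop 1,
    H.tendsto_speed.eventually_ge_atTop (2 * Real.log 3 / η)] with n hn hn1 hs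
  have hn' : (1 : ℝ) ≤ n := by exact_mod_cast hn1
  rw [Real.norm_of_nonneg (Real.log_nonneg hn'), Real.norm_of_nonneg (by positivity)] at hn
  have h3 : Real.log (2 * n + 1) ≤ Real.log 3 + Real.log n := by
    rw [← Real.log_mul (by norm_num) (by positivity)]
    exact Real.log_le_log (by positivity) (by linarith)
  rw [div_le_iff₀ hη] at hs
  change Real.log n ≤ η / 2 * speed k α n at hn
  linarith

/-- Apart from the logarithm, the exponents are α - 1/2 and 1 - 2k(1 - α); their order is exactly
`mul_lt`. -/
theorem eventually_fluctuation_le (H : ModerateScale k α) {η : ℝ} (hη : 0 < η) :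
    ∀ᶠ n : ℕ in atTop, n * scale α n * √(Real.log n / n) ≤ η * speed k α n := by
  have hp : 0 < 1 / 2 - (2 * (k : ℝ) - 1) * (1 - α) := by linarith [H.mul_lt]
  have h1 := (isLittleO_log_rpow_rpow_atTop (1 / 2) hp).bound hη
  have h2 := (tendsto_natCast_atTop_atTop (R := ℝ)).eventually h1
  filter_upwards [h2, eventually_ge_atTop 1] with n hn hn1
  have hn' : (1 : ℝ) ≤ n := by exact_mod_cast hn1
  have hn0 : (0 : ℝ) < n := by linarith
  have hl := Real.log_nonneg hn'
  rw [Real.norm_of_nonneg (by positivity), Real.norm_of_nonneg (by positivity)] at hn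
  rw [Real.sqrt_div hl, Real.sqrt_eq_rpow, Real.sqrt_eq_rpow]
  have e1 : n * scale α n * (Real.log n ^ (1 / 2 : ℝ) / (n : ℝ) ^ (1 / 2 : ℝ))
      = (n : ℝ) ^ (α - 1 / 2) * Real.log n ^ (1 / 2 : ℝ) := by
    have : (n : ℝ) ^ (α - 1 / 2) = n * scale α n / (n : ℝ) ^ (1 / 2 : ℝ) := by
      rw [scale]
      nth_rewrite 2 [← Real.rpow_one (n : ℝ)]
      rw [← Real.rpow_add hn0, ← Real.rpow_sub hn0]
      congr 1
      ring
    rw [this]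
    ring
  rw [e1]
  calc (n : ℝ) ^ (α - 1 / 2) * Real.log n ^ (1 / 2 : ℝ)
      ≤ (n : ℝ) ^ (α - 1 / 2) * (η * (n : ℝ) ^ (1 / 2 - (2 * (k : ℝ) - 1) * (1 - α))) := by gcongr
    _ = η * speed k α n := by
      rw [speed, mul_left_comm, ← Real.rpow_add hn0]
      congr 2
      ring

end ModerateScale

/-! ### Exponential asymptotics of weights near m -/

/-- Expansion of `g` at `m` together with the closeness of the quenched functions to `g`.
`κ` is the leading coefficient, `κ₁` the quadratic one, and `c` the factor relating the
magnetization to the optimal tilt. -/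
structure QuenchedExpansion (β m κ κ₁ c A : ℝ) (k : ℕ) (h : ℕ → ℝ) (g : ℝ → ℝ) : Prop where
  beta_pos : 0 < β
  coeff_pos : 0 < κ
  radius_pos : 0 < A
  radius_le : A ≤ 1
  quadratic : (k = 1 ∧ κ₁ = κ) ∨ (2 ≤ k ∧ κ₁ = 0)
  tilt_factor : β * (1 - c) + 2 * κ₁ * c = 0
  expansion : ∃ L, ∀ u, |u| ≤ A →
    |g (m + u) - g m - κ * u ^ (2 * k)| ≤ L * |u| ^ (2 * k + 1)
  lower : ∀ u, |u| ≤ A → κ / 2 * u ^ (2 * k) ≤ g (m + u) - g m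
  close : ∃ K, ∀ᶠ n : ℕ in atTop, ∀ u : ℝ, |u| ≤ 1 →
    |(empiricalG β h n (m + u) - empiricalG β h n m) - (g (m + u) - g m)|
      ≤ K * (|u| * √(Real.log n / n) + 1 / n)

namespace QuenchedExpansion

variable {β m κ κ₁ c A α : ℝ} {k : ℕ} {h : ℕ → ℝ} {g : ℝ → ℝ}

theorem one_le (H : QuenchedExpansion β m κ κ₁ c A k h g) : 1 ≤ k := by
  rcases H.quadratic with h1 | h1 <;> omega

theorem eventually_close (H : QuenchedExpansion β m κ κ₁ c A k h g) (hs : ModerateScale k α)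
    {η : ℝ} (hη : 0 < η) : ∀ᶠ n : ℕ in atTop, ∀ z : ℝ, scale α n * |z| ≤ 1 →
      |n * (empiricalG β h n (m + scale α n * z) - empiricalG β h n m)
        - n * (g (m + scale α n * z) - g m)| ≤ η * speed k α n * (|z| + 1) := by
  obtain ⟨K, hK⟩ := H.close
  have hK1 : 0 < |K| + 1 := by positivity
  filter_upwards [hK, hs.eventually_fluctuation_le (div_pos hη hK1), eventually_ge_atTop 1,
    hs.tendsto_speed.eventually_ge_atTop ((|K| + 1) / η)] with n h1 h2 hn h3 z hz
  have hn0 : n ≠ 0 := by omega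
  have hn' : (0 : ℝ) < n := by positivity
  have he := scale_pos α hn0
  have habs : |scale α n * z| = scale α n * |z| := by rw [abs_mul, abs_of_pos he]
  have h4 := h1 (scale α n * z) (by rw [habs]; exact hz)
  rw [habs] at h4
  rw [← mul_sub, abs_mul, abs_of_pos hn']
  rw [div_le_iff₀ hη] at h3
  rw [div_mul_eq_mul_div, le_div_iff₀ hK1] at h2
  calc n * _ ≤ n * (K * (scale α n * |z| * √(Real.log n / n) + 1 / n)) := by gcongr
    _ ≤ n * ((|K| + 1) * (scale α n * |z| * √(Real.log n / n) + 1 / n)) := by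
        gcongr
        linarith [le_abs_self K]
    _ = n * scale α n * √(Real.log n / n) * (|K| + 1) * |z| + (|K| + 1) := by field_simp
    _ ≤ η * speed k α n * |z| + speed k α n * η := by gcongr
    _ = η * speed k α n * (|z| + 1) := by ring

theorem eventually_near (H : QuenchedExpansion β m κ κ₁ c A k h g) (hs : ModerateScale k α)
    (R : ℝ) {η : ℝ} (hη : 0 < η) : ∀ᶠ n : ℕ in atTop, ∀ z : ℝ, |z| ≤ R →
      |n * (empiricalG β h n (m + scale α n * z) - empiricalG β h n m)
        - speed k α n * (κ * z ^ (2 * k))| ≤ η * speed k α n := by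
  rcases lt_or_ge R 0 with hR | hR
  · exact Eventually.of_forall fun n z hz => absurd (abs_nonneg z) (by linarith)
  obtain ⟨L, hL⟩ := H.expansion
  have hη' : 0 < η / (2 * (R + 1)) := by positivity
  have hR1 : Tendsto (fun n => scale α n * R) atTop (𝓝 0) := by
    simpa using hs.tendsto_scale.mul_const R
  have hL1 : Tendsto (fun n => scale α n * (|L| * R ^ (2 * k + 1))) atTop (𝓝 0) := by
    simpa using hs.tendsto_scale.mul_const (|L| * R ^ (2 * k + 1))
  filter_upwards [H.eventually_close hs hη', eventually_ge_atTop 1,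
    hR1.eventually_le_const H.radius_pos, hL1.eventually_le_const (half_pos hη)]
    with n h1 hn h2 h3 z hz
  have hn0 : n ≠ 0 := by omega
  have hn' : (0 : ℝ) < n := by positivity
  have he := scale_pos α hn0
  have hsp := speed_pos k α hn0
  have hez : scale α n * |z| ≤ A := le_trans (by gcongr) h2
  have habs : |scale α n * z| = scale α n * |z| := by rw [abs_mul, abs_of_pos he]
  have h4 := h1 z (hez.trans H.radius_le)
  have h5 := hL (scale α n * z) (by rw [habs]; exact hez)
  have h6 : |n * (g (m + scale α n * z) - g m) - speed k α n * (κ * z ^ (2 * k))|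
      ≤ η / 2 * speed k α n := by
    have e : n * (g (m + scale α n * z) - g m) - speed k α n * (κ * z ^ (2 * k))
        = n * (g (m + scale α n * z) - g m - κ * (scale α n * z) ^ (2 * k)) := by
      rw [speed_eq k α hn0, mul_pow]
      ring
    rw [e, abs_mul, abs_of_pos hn']
    calc n * _ ≤ n * (L * |scale α n * z| ^ (2 * k + 1)) := by gcongr
      _ ≤ n * (|L| * |scale α n * z| ^ (2 * k + 1)) := by gcongr; exact le_abs_self L
      _ = speed k α n * (scale α n * (|L| * |z| ^ (2 * k + 1))) := by
          rw [habs, mul_pow, speed_eq k α hn0]; ring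
      _ ≤ speed k α n * (scale α n * (|L| * R ^ (2 * k + 1))) := by gcongr
      _ ≤ speed k α n * (η / 2) := by gcongr
      _ = η / 2 * speed k α n := by ring
  have h7 : η / (2 * (R + 1)) * speed k α n * (|z| + 1) ≤ η / 2 * speed k α n := by
    calc _ ≤ η / (2 * (R + 1)) * speed k α n * (R + 1) := by gcongr
      _ = η / 2 * speed k α n := by field_simp
  refine (abs_sub_le _ _ _).trans ((add_le_add (h4.trans h7) h6).trans (le_of_eq (by ring)))

/-- For k ≥ 2 the speed is smaller than n·scale² by a factor scale^(2k-2), so on this coarser scale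
the increment vanishes, in agreement with κ₁ = 0. -/
theorem eventually_near_quadratic (H : QuenchedExpansion β m κ κ₁ c A k h g)
    (hs : ModerateScale k α) (R : ℝ) {η : ℝ} (hη : 0 < η) :
    ∀ᶠ n : ℕ in atTop, ∀ z : ℝ, |z| ≤ R →
      |n * (empiricalG β h n (m + scale α n * z) - empiricalG β h n m)
        - n * scale α n ^ 2 * (κ₁ * z ^ 2)| ≤ η * (n * scale α n ^ 2) := by
  rcases H.quadratic with ⟨rfl, hκ⟩ | ⟨hk, hκ⟩
  · filter_upwards [H.eventually_near hs R hη, eventually_ge_atTop 1] with n h1 hn z hz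
    have h2 := h1 z hz
    rw [speed_eq 1 α (by omega), mul_one] at h2
    rw [hκ]
    exact h2
  · rcases lt_or_ge R 0 with hR | hR
    · exact Eventually.of_forall fun n z hz => absurd (abs_nonneg z) (by linarith)
    have hlim : Tendsto (fun n => (κ * R ^ (2 * k) + 1) * scale α n ^ (2 * k - 2)) atTop (𝓝 0) := by
      have := (hs.tendsto_scale.pow (2 * k - 2)).const_mul (κ * R ^ (2 * k) + 1)
      rwa [zero_pow (by omega), mul_zero] at this
    filter_upwards [H.eventually_near hs R one_pos, eventually_ge_atTop 1,
      hlim.eventually_le_const hη] with n h1 hn h3 z hz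
    have hn0 : n ≠ 0 := by omega
    have hκ0 := H.coeff_pos
    have hsp := speed_pos k α hn0
    have he := scale_pos α hn0
    have h2 := h1 z hz
    rw [hκ, zero_mul, mul_zero, sub_zero]
    have h4 : |speed k α n * (κ * z ^ (2 * k))| ≤ speed k α n * (κ * R ^ (2 * k)) := by
      rw [abs_mul, abs_mul, abs_pow, abs_of_pos hsp, abs_of_pos hκ0]
      gcongr
    set p := n * (empiricalG β h n (m + scale α n * z) - empiricalG β h n m)
    have h5 : |p| ≤ |p - speed k α n * (κ * z ^ (2 * k))| + |speed k α n * (κ * z ^ (2 * k))| := by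
      have := abs_add_le (p - speed k α n * (κ * z ^ (2 * k))) (speed k α n * (κ * z ^ (2 * k)))
      rwa [sub_add_cancel] at this
    have hsplit : speed k α n = n * scale α n ^ 2 * scale α n ^ (2 * k - 2) := by
      rw [speed_eq k α hn0, mul_assoc, ← pow_add]
      congr 2
      omega
    calc |p| ≤ speed k α n * (κ * R ^ (2 * k) + 1) := by linarith
      _ = n * scale α n ^ 2 * ((κ * R ^ (2 * k) + 1) * scale α n ^ (2 * k - 2)) := by
          rw [hsplit]; ring
      _ ≤ n * scale α n ^ 2 * η := by gcongr
      _ = η * (n * scale α n ^ 2) := by ring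

/-- The expansion is uniform only for bounded z. Beyond that, `lower` gives growth κ|z|/2, of which
the fluctuations take at most half. -/
theorem eventually_far (H : QuenchedExpansion β m κ κ₁ c A k h g) (hs : ModerateScale k α) :
    ∀ᶠ n : ℕ in atTop, ∀ z : ℝ, 1 ≤ |z| → scale α n * |z| ≤ A →
      speed k α n * (κ / 4 * |z|)
        ≤ n * (empiricalG β h n (m + scale α n * z) - empiricalG β h n m) := by
  have hκ := H.coeff_pos
  filter_upwards [H.eventually_close hs (show 0 < κ / 8 by positivity), eventually_ge_atTop 1]
    with n h1 hn z hz1 hz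
  have hn0 : n ≠ 0 := by omega
  have hn' : (0 : ℝ) < n := by positivity
  have he := scale_pos α hn0
  have hsp := speed_pos k α hn0
  have habs : |scale α n * z| = scale α n * |z| := by rw [abs_mul, abs_of_pos he]
  have h2 := (abs_le.mp (h1 z (hz.trans H.radius_le))).1
  have h3 := H.lower (scale α n * z) (by rw [habs]; exact hz)
  have h4 : speed k α n * (κ / 2 * z ^ (2 * k)) ≤ n * (g (m + scale α n * z) - g m) := by
    calc _ = n * (κ / 2 * (scale α n * z) ^ (2 * k)) := by
          rw [speed_eq k α hn0, mul_pow]; ring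
      _ ≤ _ := by gcongr
  have h5 : |z| ≤ z ^ (2 * k) := by
    rw [pow_mul, ← sq_abs, ← pow_mul]
    exact le_self_pow₀ hz1 (by have := H.one_le; omega)
  have h6 : speed k α n * (κ / 2 * |z|) ≤ speed k α n * (κ / 2 * z ^ (2 * k)) := by gcongr
  have h7 : κ / 8 * speed k α n * (|z| + 1) ≤ κ / 8 * speed k α n * (2 * |z|) := by
    gcongr; linarith
  nlinarith

/-- The square in `weight_eq` lives on the scale n·scale²; this equals the speed if k = 1, while c =
1 if k ≥ 2. -/
theorem scale_sq_mul (H : QuenchedExpansion β m κ κ₁ c A k h g) {n : ℕ} (hn : n ≠ 0) :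
    n * scale α n ^ 2 * (1 - c) = speed k α n * (1 - c) := by
  rcases H.quadratic with ⟨rfl, -⟩ | ⟨-, hκ⟩
  · rw [speed_eq 1 α hn, mul_one]
  · have h1 := H.tilt_factor
    rw [hκ, mul_zero, zero_mul, add_zero] at h1
    have : 1 - c = 0 := (mul_eq_zero.mp h1).resolve_left H.beta_pos.ne'
    rw [this, mul_zero, mul_zero]

/-- Exponential upper bound for the weight of magnetizations close to `m`. -/
theorem eventually_weightOf_le (H : QuenchedExpansion β m κ κ₁ c A k h g)
    (hs : ModerateScale k α) {a : ℝ} (ha : a ≤ A) {C : Set ℝ} {M : ℝ}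
    (hM : ∀ z ∈ C, M ≤ κ * (c * z) ^ (2 * k) - β / 2 * (1 - c) ^ 2 * z ^ 2)
    {η : ℝ} (hη : 0 < η) : ∀ᶠ n : ℕ in atTop,
      weightOf β h n (Set.Icc (m - a) (m + a) ∩ {y | (y - m) / scale α n ∈ C})
        ≤ 2 ^ n * Real.exp (-(n * empiricalG β h n m)) * Real.exp (-(speed k α n * (M - η))) := by
  have hκ := H.coeff_pos
  -- Past R the linear bound κ|z|/4 of `eventually_far` already exceeds M, so there the tilt can be
  -- centred at y itself, with no square left.
  set R : ℝ := max 1 (4 * M / κ) with hR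
  filter_upwards [H.eventually_near hs (|c| * R) (half_pos hη), H.eventually_far hs,
    hs.eventually_log_le (half_pos hη), eventually_ge_atTop 1] with n hnear hfar hlog hn
  have hn0 : n ≠ 0 := by omega
  have hn' : (0 : ℝ) < n := by positivity
  have he := scale_pos α hn0
  have hsp := speed_pos k α hn0
  refine (weightOf_le β h hn0 _
    (fun y => if |(y - m) / scale α n| ≤ R then m + c * (y - m) else y)
    (-(n * empiricalG β h n m) - speed k α n * (M - η / 2)) ?_).trans ?_
  · rintro y ⟨hya, hyC⟩
    simp only [Set.mem_ofPred_eq] at hyC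
    set z := (y - m) / scale α n with hz
    have hy : y = m + scale α n * z := by rw [hz]; field_simp; ring
    have hym : y - m = scale α n * z := by rw [hy]; ring
    have hsq := H.scale_sq_mul (α := α) hn0
    split_ifs with hzR
    · have h1 := (abs_le.mp (hnear (c * z) (by rw [abs_mul]; gcongr))).1
      have h2 := mul_le_mul_of_nonneg_left (hM z hyC) hsp.le
      have e1 : m + c * (y - m) = m + scale α n * (c * z) := by rw [hym]; ring
      have e2 : n * (β / 2) * (y - (m + scale α n * (c * z))) ^ 2
          = speed k α n * (β / 2 * (1 - c) ^ 2 * z ^ 2) := by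
        rw [hy]
        linear_combination (β / 2 * (1 - c) * z ^ 2) * hsq
      rw [e1, e2]
      nlinarith
    · push Not at hzR
      have hz1 : 1 ≤ |z| := (le_max_left _ _).trans hzR.le
      have hza : scale α n * |z| ≤ A := by
        have h3 : |y - m| ≤ a := by
          rw [abs_le]; constructor <;> linarith [hya.1, hya.2]
        rw [hym, abs_mul, abs_of_pos he] at h3
        exact h3.trans ha
      have h1 := hfar z hz1 hza
      have h2 : M ≤ κ / 4 * |z| := by
        have h3 : 4 * M / κ ≤ |z| := (le_max_right _ _).trans hzR.le
        rw [div_le_iff₀ hκ] at h3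
        linarith
      have h4 := mul_le_mul_of_nonneg_left h2 hsp.le
      have h5 : 0 < speed k α n * (η / 2) := by positivity
      rw [sub_self, hy]
      nlinarith
  · have h1 : (2 * n + 1 : ℝ) ≤ Real.exp (η / 2 * speed k α n) := by
      rw [← Real.log_le_iff_le_exp (by positivity)]
      exact hlog
    calc (2 * n + 1 : ℝ) * (2 ^ n * Real.exp (-(n * empiricalG β h n m)
          - speed k α n * (M - η / 2)))
        ≤ Real.exp (η / 2 * speed k α n) * (2 ^ n * Real.exp (-(n * empiricalG β h n m)
          - speed k α n * (M - η / 2))) := by gcongr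
      _ = 2 ^ n * (Real.exp (η / 2 * speed k α n) * Real.exp (-(n * empiricalG β h n m)
          - speed k α n * (M - η / 2))) := by ring
      _ = _ := by
        rw [mul_assoc, ← Real.exp_add, ← Real.exp_add]
        congr 2
        ring

/-- Chernoff bound for the tilted measure centred at scaled magnetization `z₀`. -/
theorem eventually_tiltOf_le (H : QuenchedExpansion β m κ κ₁ c A k h g)
    (hs : ModerateScale k α) (z₀ : ℝ) {δ : ℝ} (hδ : δ ≠ 0) : ∀ᶠ n : ℕ in atTop,
      tiltOf β h n (m + scale α n * (c * z₀))
        {y | δ ^ 2 ≤ δ * ((y - m) / scale α n - z₀)} ≤ 1 / 4 := by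
  have hβ := H.beta_pos
  have hκ₁ : 0 ≤ κ₁ := by
    rcases H.quadratic with ⟨-, h1⟩ | ⟨-, h1⟩
    · rw [h1]; exact H.coeff_pos.le
    · rw [h1]
  have hδ2 : 0 < δ ^ 2 := by positivity
  filter_upwards [H.eventually_near_quadratic hs (|c * z₀| + |δ|)
      (show 0 < β * δ ^ 2 / 8 by positivity),
    hs.tendsto_mul_scale_sq.eventually_ge_atTop (Real.log 4 / (β * δ ^ 2 / 4)),
    eventually_ge_atTop 1] with n hnear hbig hn
  have hn0 : n ≠ 0 := by omega
  have hn' : (0 : ℝ) < n := by positivity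
  have he := scale_pos α hn0
  rw [div_le_iff₀ (by positivity)] at hbig
  have h1 := (abs_le.mp (hnear (c * z₀) (le_add_of_nonneg_right (abs_nonneg _)))).2
  have h2 := (abs_le.mp (hnear (c * z₀ + δ) (abs_add_le _ _))).1
  have h4 : (1 / 4 : ℝ) = Real.exp (-Real.log 4) := by
    rw [Real.exp_neg, Real.exp_log (by norm_num)]; norm_num
  rw [h4]
  -- The sign of δ selects the upper or the lower tail.
  refine tiltOf_le β h hn0 _ (m + scale α n * (c * z₀ + δ)) _ _ ?_
  intro y hy
  simp only [Set.mem_ofPred_eq] at hy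
  set z := (y - m) / scale α n with hz
  have hyz : y = m + scale α n * z := by rw [hz]; field_simp; ring
  have e : n * (β / 2) * ((y - (m + scale α n * (c * z₀ + δ))) ^ 2
      - (y - (m + scale α n * (c * z₀))) ^ 2)
      = n * scale α n ^ 2 * (β / 2 * (-2 * (δ * (z - z₀)) - 2 * δ * (1 - c) * z₀ + δ ^ 2)) := by
    rw [hyz]; ring
  rw [e]
  set w := n * scale α n ^ 2 with hw
  have hw0 : 0 < w := by positivity
  have h5 : w * (β / 2 * (-2 * (δ * (z - z₀)) - 2 * δ * (1 - c) * z₀ + δ ^ 2))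
      ≤ w * (β / 2 * (-2 * δ ^ 2 - 2 * δ * (1 - c) * z₀ + δ ^ 2)) := by
    gcongr _ * (_ * (?_ - _ + _))
    linarith
  -- Stationarity of c cancels the terms linear in δ. Of the remaining -βδ²/2, the two approximation
  -- errors use βδ²/4.
  have h6 : w * (κ₁ * (c * z₀) ^ 2) - w * (κ₁ * (c * z₀ + δ) ^ 2)
      + w * (β / 2 * (-2 * δ ^ 2 - 2 * δ * (1 - c) * z₀ + δ ^ 2))
      = -(w * (κ₁ * δ ^ 2)) - w * (β * δ ^ 2 / 2) := by
    linear_combination (-w * δ * z₀) * H.tilt_factor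
  have h7 : 0 ≤ w * (κ₁ * δ ^ 2) := by positivity
  linarith

/-- Exponential lower bound for the weight of magnetizations at scaled distance `< δ` of `z₀`. -/
theorem eventually_le_weightOf (H : QuenchedExpansion β m κ κ₁ c A k h g)
    (hs : ModerateScale k α) {a : ℝ} (ha : 0 < a) (z₀ : ℝ) {δ : ℝ} (hδ : 0 < δ)
    {η : ℝ} (hη : 0 < η) : ∀ᶠ n : ℕ in atTop,
      2 ^ n * Real.exp (-(n * empiricalG β h n m)) * Real.exp (-(speed k α n
        * (κ * (c * z₀) ^ (2 * k) - β / 2 * (1 - c) ^ 2 * z₀ ^ 2 + η)))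
      ≤ weightOf β h n (Set.Icc (m - a) (m + a) ∩
        {y | (y - m) / scale α n ∈ Metric.ball z₀ δ}) := by
  have hβ := H.beta_pos
  -- The loss η is shared by the cross term of the square, the approximation of G_n, and the tilted
  -- probability 1/2.
  obtain ⟨d, hd0, hdδ, hdη⟩ : ∃ d : ℝ, 0 < d ∧ d ≤ δ ∧ β * |1 - c| * |z₀| * d ≤ η / 3 := by
    refine ⟨min δ (η / (3 * (β * |1 - c| * |z₀| + 1))), by positivity, min_le_left _ _, ?_⟩
    have hq : 0 ≤ β * |1 - c| * |z₀| := by positivity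
    calc β * |1 - c| * |z₀| * _ ≤ (β * |1 - c| * |z₀| + 1)
          * (η / (3 * (β * |1 - c| * |z₀| + 1))) := by
          gcongr
          · linarith
          · exact min_le_right _ _
      _ = η / 3 := by field_simp
  have hlim : Tendsto (fun n => scale α n * (|z₀| + d)) atTop (𝓝 0) := by
    simpa using hs.tendsto_scale.mul_const (|z₀| + d)
  have hη3 : 0 < η / 3 := by positivity
  filter_upwards [H.eventually_near hs |c * z₀| hη3, H.eventually_tiltOf_le hs z₀ hd0.ne',
    H.eventually_tiltOf_le hs z₀ (neg_ne_zero.mpr hd0.ne'), hlim.eventually_le_const ha,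
    hs.tendsto_speed.eventually_ge_atTop (Real.log 2 / (η / 3)), eventually_ge_atTop 1]
    with n hnear ht1 ht2 hna hbig hn
  have hn0 : n ≠ 0 := by omega
  have hn' : (0 : ℝ) < n := by positivity
  have he := scale_pos α hn0
  have hsp := speed_pos k α hn0
  set x := m + scale α n * (c * z₀) with hx
  set T : Set ℝ := {y | (y - m) / scale α n ∈ Metric.ball z₀ d} with hT
  have htilt : 1 / 2 ≤ tiltOf β h n x T := by
    have h1 := one_le_tiltOf_add (β := β) (h := h) (n := n) (x := x) (T := T)
      (T₁ := {y | d ^ 2 ≤ d * ((y - m) / scale α n - z₀)})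
      (T₂ := {y | (-d) ^ 2 ≤ (-d) * ((y - m) / scale α n - z₀)}) (by
        refine Set.eq_univ_of_forall fun y => ?_
        simp only [hT, Set.mem_union, Set.mem_ofPred_eq, Metric.mem_ball, Real.dist_eq]
        by_contra! hcon
        obtain ⟨h1, h2, h3⟩ := hcon
        rcases le_abs.mp h1 with h4 | h4 <;> nlinarith)
    linarith
  have hb : ∀ y ∈ T, -(n * empiricalG β h n x) + speed k α n
      * (β / 2 * (1 - c) ^ 2 * z₀ ^ 2 - η / 3)
      ≤ -(n * empiricalG β h n x) + n * (β / 2) * (y - x) ^ 2 := by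
    intro y hy
    simp only [hT, Set.mem_ofPred_eq, Metric.mem_ball, Real.dist_eq] at hy
    set z := (y - m) / scale α n with hz
    have hyz : y = m + scale α n * z := by rw [hz]; field_simp; ring
    have hsq := H.scale_sq_mul (α := α) hn0
    -- The pure square may exceed the speed, but it is nonnegative and can be dropped; the other
    -- terms carry 1 - c and so have the order of the speed.
    have e : n * (β / 2) * (y - x) ^ 2 = n * scale α n ^ 2 * (β / 2) * (z - z₀) ^ 2
        + speed k α n * (β * ((1 - c) * z₀ * (z - z₀)) + β / 2 * (1 - c) ^ 2 * z₀ ^ 2) := by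
      rw [hyz, hx]
      linear_combination (β * z₀ * (z - z₀) + β / 2 * (1 - c) * z₀ ^ 2) * hsq
    have h1 : -(η / 3) ≤ β * ((1 - c) * z₀ * (z - z₀)) := by
      have h2 : |β * ((1 - c) * z₀ * (z - z₀))| ≤ η / 3 := by
        rw [abs_mul, abs_mul, abs_mul, abs_of_pos hβ]
        refine le_trans ?_ hdη
        calc _ = β * |1 - c| * |z₀| * |z - z₀| := by ring
          _ ≤ _ := by gcongr
      exact (abs_le.mp h2).1
    have h3 := mul_le_mul_of_nonneg_left h1 hsp.le
    have h4 : 0 ≤ n * scale α n ^ 2 * (β / 2) * (z - z₀) ^ 2 := by positivity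
    rw [e]
    linarith
  have h8 := le_weightOf β h hn0 T x _ hb
  have hsub : T ⊆ Set.Icc (m - a) (m + a) ∩ {y | (y - m) / scale α n ∈ Metric.ball z₀ δ} := by
    intro y hy
    have hy' := hy
    simp only [hT, Set.mem_ofPred_eq, Metric.mem_ball, Real.dist_eq] at hy
    refine ⟨?_, Metric.ball_subset_ball hdδ hy'⟩
    set z := (y - m) / scale α n with hz
    have hym : y - m = scale α n * z := by rw [hz]; field_simp
    have h1 : |z| ≤ |z₀| + d := by
      have := abs_sub_abs_le_abs_sub z z₀
      linarith
    have h2 : |y - m| ≤ a := by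
      rw [hym, abs_mul, abs_of_pos he]
      exact le_trans (by gcongr) hna
    rw [abs_le] at h2
    constructor <;> linarith [h2.1, h2.2]
  refine le_trans ?_ (h8.trans (weightOf_mono β h n hsub))
  have h1 := (abs_le.mp (hnear (c * z₀) le_rfl)).2
  have h9 : Real.exp (-(speed k α n * (η / 3))) ≤ 1 / 2 := by
    rw [div_le_iff₀ hη3] at hbig
    calc _ ≤ Real.exp (-Real.log 2) := Real.exp_le_exp.mpr (by linarith)
      _ = 1 / 2 := by rw [Real.exp_neg, Real.exp_log (by norm_num)]; norm_num
  calc _ = 2 ^ n * Real.exp (-(n * empiricalG β h n m) - speed k α n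
        * (κ * (c * z₀) ^ (2 * k) - β / 2 * (1 - c) ^ 2 * z₀ ^ 2 + 2 * η / 3))
        * Real.exp (-(speed k α n * (η / 3))) := by
        rw [mul_assoc (2 ^ n), mul_assoc (2 ^ n), ← Real.exp_add, ← Real.exp_add]
        congr 2
        ring
    _ ≤ 2 ^ n * Real.exp (-(n * empiricalG β h n x) + speed k α n
        * (β / 2 * (1 - c) ^ 2 * z₀ ^ 2 - η / 3)) * tiltOf β h n x T := by
        gcongr
        · nlinarith
        · exact h9.trans htilt

end QuenchedExpansion

/-! ### From weights to the deviations principle -/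

theorem partitionFunction_pos (β : ℝ) (h : ℕ → ℝ) (n : ℕ) : 0 < partitionFunction β h n :=
  Finset.sum_pos (fun σ _ => weight_pos β h σ)
    ⟨fun _ => ⟨1, by simp⟩, Finset.mem_univ _⟩

theorem gibbs_apply (β : ℝ) (h : ℕ → ℝ) {n : ℕ} {U : Set (Config n)} {T : Set ℝ}
    (hUT : ∀ σ, σ ∈ U ↔ magnetization σ / n ∈ T) :
    gibbs β h n U = ENNReal.ofReal (weightOf β h n T / partitionFunction β h n) := by
  classical
  have hZ := partitionFunction_pos β h n
  have hU : MeasurableSet U := U.toFinite.measurableSet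
  rw [gibbs, weightOf, Measure.coe_finsetSum, Finset.sum_apply, Finset.sum_div,
    ENNReal.ofReal_sum_of_nonneg fun σ _ => (div_pos (weight_pos β h σ) hZ).le,
    Finset.sum_filter]
  refine Finset.sum_congr rfl fun σ _ => ?_
  rw [Measure.smul_apply, Measure.dirac_apply' _ hU, smul_eq_mul, Set.indicator_apply]
  by_cases hσ : σ ∈ U
  · rw [if_pos hσ, if_pos ((hUT σ).mp hσ), Pi.one_apply, mul_one]
  · rw [if_neg hσ, if_neg fun hT => hσ ((hUT σ).mpr hT), mul_zero]

theorem conditionedLaw_apply (β : ℝ) (h : ℕ → ℝ) (m a α : ℝ) {n : ℕ} (hn : n ≠ 0) {C : Set ℝ}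
    (hC : MeasurableSet C) (hpos : 0 < weightOf β h n (Set.Icc (m - a) (m + a))) :
    conditionedLaw β h m a α n C = ENNReal.ofReal
      (weightOf β h n (Set.Icc (m - a) (m + a) ∩ {y | (y - m) / scale α n ∈ C})
        / weightOf β h n (Set.Icc (m - a) (m + a))) := by
  have hn' : (0 : ℝ) < n := by positivity
  have hZ := partitionFunction_pos β h n
  have hmeas : Measurable fun σ : Config n => (magnetization σ - n * m) / (n : ℝ) ^ α :=
    measurable_of_finite _
  have hfun : ∀ σ : Config n, (magnetization σ - n * m) / (n : ℝ) ^ α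
      = (magnetization σ / n - m) / scale α n := by
    intro σ
    rw [scale, Real.rpow_sub hn', Real.rpow_one]
    have := Real.rpow_pos_of_pos hn' α
    field_simp
  rw [conditionedLaw, Measure.map_apply hmeas hC, cond_apply (Set.toFinite _).measurableSet,
    gibbs_apply β h (U := {σ : Config n | magnetization σ / n ∈ Set.Icc (m - a) (m + a)})
      (T := Set.Icc (m - a) (m + a)) fun σ => Iff.rfl,
    gibbs_apply β h (U := {σ : Config n | magnetization σ / n ∈ Set.Icc (m - a) (m + a)} ∩ _)
      (T := Set.Icc (m - a) (m + a) ∩ {y | (y - m) / scale α n ∈ C}) fun σ => by simp [hfun],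
    ← ENNReal.ofReal_inv_of_pos (div_pos hpos hZ),
    ← ENNReal.ofReal_mul (inv_nonneg.mpr (div_pos hpos hZ).le)]
  congr 1
  field_simp

theorem le_log_ofReal_div {s p t : ℝ} (hs : 0 < s) (hp : Real.exp (s * t) ≤ p) :
    (t : EReal) ≤ ENNReal.log (ENNReal.ofReal p) / (s : EReal) := by
  rw [EReal.le_div_iff_mul_le (by exact_mod_cast hs) (EReal.coe_ne_top s)]
  refine le_trans ?_ (ENNReal.log_le_log (ENNReal.ofReal_le_ofReal hp))
  rw [ENNReal.log_ofReal_of_pos (Real.exp_pos _), Real.log_exp, mul_comm, EReal.coe_mul]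

theorem log_ofReal_div_le {s p t : ℝ} (hs : 0 < s) (hp : p ≤ Real.exp (s * t)) :
    ENNReal.log (ENNReal.ofReal p) / (s : EReal) ≤ t := by
  rw [EReal.div_le_iff_le_mul (by exact_mod_cast hs) (EReal.coe_ne_top s)]
  refine (ENNReal.log_le_log (ENNReal.ofReal_le_ofReal hp)).trans ?_
  rw [ENNReal.log_ofReal_of_pos (Real.exp_pos _), Real.log_exp, EReal.coe_mul]

/-- Monomials of positive even degree are good rate functions. -/
theorem lowerSemicontinuous_and_isCompact_level {w : ℝ} (hw : 0 < w) {k : ℕ} (hk : 1 ≤ k)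
    {I : ℝ → ℝ} (hI : ∀ x, I x = w * x ^ (2 * k)) :
    LowerSemicontinuous (fun x => (I x : EReal)) ∧
      ∀ c : ℝ, IsCompact {x | (I x : EReal) ≤ (c : EReal)} := by
  have hcont : Continuous I := by
    rw [show I = fun x => w * x ^ (2 * k) from funext hI]
    fun_prop
  refine ⟨(continuous_coe_real_ereal.comp hcont).lowerSemicontinuous, fun c => ?_⟩
  have hclosed : IsClosed {x | (I x : EReal) ≤ (c : EReal)} :=
    isClosed_le (continuous_coe_real_ereal.comp hcont) continuous_const
  refine (isCompact_Icc (a := -max 1 (c / w)) (b := max 1 (c / w))).of_isClosed_subset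
    hclosed fun x hx => ?_
  simp only [Set.mem_ofPred_eq, EReal.coe_le_coe_iff] at hx
  rw [Set.mem_Icc, ← abs_le]
  rcases le_total |x| 1 with h1 | h1
  · exact h1.trans (le_max_left _ _)
  · refine le_trans ?_ (le_max_right _ _)
    rw [le_div_iff₀ hw]
    have h2 : |x| ≤ x ^ (2 * k) := by
      rw [pow_mul, ← sq_abs, ← pow_mul]
      exact le_self_pow₀ h1 (by omega)
    rw [hI] at hx
    nlinarith

/-- Numerator and denominator share the factor `N n`, and the denominator is `N n` up to
exp(±η·speed) since I ≥ 0 = I(0). The upper bound holds for all sets at once, as the weight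
estimates are uniform over the window. -/
theorem QuenchedExpansion.satisfiesLDP {β m κ κ₁ c A α : ℝ} {k : ℕ} {h : ℕ → ℝ} {g : ℝ → ℝ}
    (H : QuenchedExpansion β m κ κ₁ c A k h g) (hs : ModerateScale k α) {a : ℝ} (ha : 0 < a)
    (haA : a ≤ A) {I : ℝ → ℝ} {w : ℝ} (hw : 0 < w) (hIw : ∀ x, I x = w * x ^ (2 * k))
    (hI : ∀ z, I z = κ * (c * z) ^ (2 * k) - β / 2 * (1 - c) ^ 2 * z ^ 2) :
    SatisfiesLDP (conditionedLaw β h m a α) (speed k α) (fun x => (I x : EReal)) := by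
  have hgood := lowerSemicontinuous_and_isCompact_level hw H.one_le hIw
  have hI0 : ∀ z, 0 ≤ I z := fun z => by
    rw [hIw, pow_mul]
    positivity
  let N : ℕ → ℝ := fun n => 2 ^ n * Real.exp (-(n * empiricalG β h n m))
  have hN : ∀ n, 0 < N n := fun n => by positivity
  have huniv : ∀ n, Set.Icc (m - a) (m + a) ∩ {y | (y - m) / scale α n ∈ (Set.univ : Set ℝ)}
      = Set.Icc (m - a) (m + a) := fun n => by simp
  have hupper : ∀ {C : Set ℝ} {M η : ℝ}, (∀ z ∈ C, M ≤ I z) → 0 < η → ∀ᶠ n : ℕ in atTop,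
      weightOf β h n (Set.Icc (m - a) (m + a) ∩ {y | (y - m) / scale α n ∈ C})
        ≤ N n * Real.exp (-(speed k α n * (M - η))) := fun hM hη =>
    H.eventually_weightOf_le hs haA (fun z hz => hI z ▸ hM z hz) hη
  have hlower : ∀ (z₀ : ℝ) {δ η : ℝ}, 0 < δ → 0 < η → ∀ᶠ n : ℕ in atTop,
      N n * Real.exp (-(speed k α n * (I z₀ + η))) ≤ weightOf β h n
        (Set.Icc (m - a) (m + a) ∩ {y | (y - m) / scale α n ∈ Metric.ball z₀ δ}) := by
    intro z₀ δ η hδ hη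
    rw [hI]
    exact H.eventually_le_weightOf hs ha z₀ hδ hη
  have htotal_upper : ∀ {η : ℝ}, 0 < η → ∀ᶠ n : ℕ in atTop,
      weightOf β h n (Set.Icc (m - a) (m + a)) ≤ N n * Real.exp (speed k α n * η) := by
    intro η hη
    filter_upwards [hupper (C := Set.univ) (fun z _ => hI0 z) hη] with n hn
    rw [huniv] at hn
    refine hn.trans_eq ?_
    congr 2
    ring
  have htotal_lower : ∀ {η : ℝ}, 0 < η → ∀ᶠ n : ℕ in atTop,
      N n * Real.exp (-(speed k α n * η)) ≤ weightOf β h n (Set.Icc (m - a) (m + a)) := by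
    intro η hη
    filter_upwards [hlower 0 one_pos hη] with n hn
    have h0 : I 0 = 0 := by
      rw [hIw, zero_pow (by have := H.one_le; omega), mul_zero]
    rw [h0, zero_add] at hn
    exact hn.trans (weightOf_mono β h n Set.inter_subset_left)
  have hpos : ∀ᶠ n : ℕ in atTop, 0 < weightOf β h n (Set.Icc (m - a) (m + a)) := by
    filter_upwards [htotal_lower one_pos] with n hn
    exact lt_of_lt_of_le (mul_pos (hN n) (Real.exp_pos _)) hn
  refine ⟨hgood.1, hgood.2, fun C hC => ?_, fun C hC => ?_⟩
  · rw [EReal.neg_le]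
    refine le_iInf₂ fun z hz => ?_
    rw [EReal.neg_le, ← EReal.ge_of_forall_gt_iff_ge]
    intro t ht
    rw [← EReal.coe_neg, EReal.coe_lt_coe_iff] at ht
    obtain ⟨δ, hδ, hball⟩ := Metric.isOpen_iff.mp isOpen_interior z hz
    have hη : 0 < (-I z - t) / 2 := by linarith
    refine le_liminf_of_le (by isBoundedDefault) ?_
    filter_upwards [hlower z hδ hη, htotal_upper hη, hpos, eventually_ge_atTop 1]
      with n h1 h2 h3 hn
    have hn0 : n ≠ 0 := by omega
    rw [conditionedLaw_apply β h m a α hn0 hC h3]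
    refine le_log_ofReal_div (speed_pos k α hn0) ?_
    rw [le_div_iff₀ h3]
    calc Real.exp (speed k α n * t) * weightOf β h n (Set.Icc (m - a) (m + a))
        ≤ Real.exp (speed k α n * t) * (N n * Real.exp (speed k α n * ((-I z - t) / 2))) := by
          gcongr
      _ = N n * (Real.exp (speed k α n * t) * Real.exp (speed k α n * ((-I z - t) / 2))) := by ring
      _ = N n * Real.exp (-(speed k α n * (I z + (-I z - t) / 2))) := by
          rw [← Real.exp_add]
          congr 2
          ring
      _ ≤ _ := h1
      _ ≤ _ := by
          refine weightOf_mono β h n (Set.inter_subset_inter_right _ fun y hy => ?_)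
          exact interior_subset (s := C) (hball hy)
  · rw [← EReal.le_of_forall_lt_iff_le]
    intro t ht
    obtain ⟨t', ht1, ht2⟩ := EReal.lt_iff_exists_real_btwn.mp ht
    rw [EReal.coe_lt_coe_iff] at ht2
    have hM : ∀ z ∈ C, -t' ≤ I z := by
      intro z hz
      have h1 : ((-t' : ℝ) : EReal) ≤ ⨅ x ∈ closure C, (I x : EReal) := by
        rw [EReal.coe_neg]
        exact EReal.neg_le.mp ht1.le
      exact_mod_cast h1.trans (iInf₂_le z (subset_closure hz))
    have hη : 0 < (t - t') / 2 := by linarith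
    refine limsup_le_of_le (by isBoundedDefault) ?_
    filter_upwards [hupper hM hη, htotal_lower hη, hpos, eventually_ge_atTop 1]
      with n h1 h2 h3 hn
    have hn0 : n ≠ 0 := by omega
    rw [conditionedLaw_apply β h m a α hn0 hC h3]
    refine log_ofReal_div_le (speed_pos k α hn0) ?_
    rw [div_le_iff₀ h3]
    calc _ ≤ N n * Real.exp (-(speed k α n * (-t' - (t - t') / 2))) := h1
      _ = Real.exp (speed k α n * t) * (N n * Real.exp (-(speed k α n * ((t - t') / 2)))) := by
          rw [mul_left_comm, ← Real.exp_add]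
          congr 2
          ring
      _ ≤ _ := by gcongr

/-! ### Local analysis at the minimum and conclusion -/

theorem IsMinimumOfType.exists_radius {g : ℝ → ℝ} {m : ℝ} {k : ℕ} {lam : ℝ}
    (hm : IsMinimumOfType g m k lam) : ∃ A : ℝ, 0 < A ∧ A ≤ 1 ∧
      (∃ L, ∀ u, |u| ≤ A →
        |g (m + u) - g m - lam / (2 * k).factorial * u ^ (2 * k)| ≤ L * |u| ^ (2 * k + 1)) ∧
      ∀ u, |u| ≤ A → lam / (2 * k).factorial / 2 * u ^ (2 * k) ≤ g (m + u) - g m := by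
  have hκ : 0 < lam / (2 * k).factorial := div_pos hm.strength_pos (by positivity)
  set κ := lam / (2 * k).factorial with hκdef
  obtain ⟨L, hL⟩ := hm.expansion.bound
  obtain ⟨r, hr, hball⟩ := Metric.eventually_nhds_iff.mp hL
  -- The last entry makes the remainder at most half of the leading term.
  set A := min 1 (min (r / 2) (κ / (2 * (|L| + 1)))) with hA
  have hAr : A < r := lt_of_le_of_lt ((min_le_right _ _).trans (min_le_left _ _)) (by linarith)
  have hAκ : A ≤ κ / (2 * (|L| + 1)) := (min_le_right _ _).trans (min_le_right _ _)
  have hexp : ∀ u, |u| ≤ A → |g (m + u) - g m - κ * u ^ (2 * k)| ≤ L * |u| ^ (2 * k + 1) := by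
    intro u hu
    have h1 := hball (y := m + u) (by rw [Real.dist_eq, add_sub_cancel_left]; linarith)
    rw [add_sub_cancel_left, Real.norm_eq_abs, Real.norm_eq_abs, abs_pow, ← sub_sub] at h1
    exact h1
  refine ⟨A, by positivity, min_le_left _ _, ⟨L, hexp⟩, fun u hu => ?_⟩
  have h1 := (abs_le.mp (hexp u hu)).1
  have h2 : L * |u| ^ (2 * k + 1) ≤ κ / 2 * u ^ (2 * k) := by
    have he : u ^ (2 * k) = |u| ^ (2 * k) := by rw [pow_mul, ← sq_abs, ← pow_mul]
    rw [pow_succ', he, ← mul_assoc]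
    gcongr
    calc L * |u| ≤ (|L| + 1) * |u| := by gcongr; linarith [le_abs_self L]
      _ ≤ (|L| + 1) * (κ / (2 * (|L| + 1))) := by gcongr; exact hu.trans hAκ
      _ = κ / 2 := by field_simp
  linarith

/-- At a minimum of type one the strength is smaller than `β`. -/
theorem IsMinimumOfType.strength_lt {β : ℝ} (hβ : 0 < β) {ν : Measure ℝ}
    [IsProbabilityMeasure ν] (hν : Integrable (fun y : ℝ => y ^ 2) ν) {m lam : ℝ}
    (hm : IsMinimumOfType (G β ν) m 1 lam) : lam < β := by
  obtain ⟨A, hA, -, ⟨L, hL⟩, -⟩ := hm.exists_radius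
  obtain ⟨q, hq, hsymm⟩ := exists_symm_increment_le hβ hν m
  have hlim : Tendsto (fun u : ℝ => 2 * L * u) (𝓝 0) (𝓝 0) := by
    have : Continuous fun u : ℝ => 2 * L * u := by fun_prop
    simpa using this.tendsto 0
  have hev : ∀ᶠ u : ℝ in 𝓝[>] 0, 0 < u ∧ u ≤ A ∧ 2 * L * u < q ∧
      (G β ν (m + u) - G β ν m) + (G β ν (m - u) - G β ν m) ≤ (β - q) * u ^ 2 := by
    filter_upwards [self_mem_nhdsWithin,
      nhdsWithin_le_nhds (eventually_le_nhds hA),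
      nhdsWithin_le_nhds (hlim.eventually_lt_const hq), nhdsWithin_le_nhds hsymm]
      with u h1 h2 h3 h4 using ⟨h1, h2, h3, h4⟩
  obtain ⟨u, hu0, huA, huq, hu⟩ := hev.exists
  -- Adding the expansions at u and -u gives λu² - 2Lu³ ≤ (β - q)u², and 2Lu < q.
  have h1 := (abs_le.mp (hL u (by rwa [abs_of_pos hu0]))).1
  have h2 := (abs_le.mp (hL (-u) (by rwa [abs_neg, abs_of_pos hu0]))).1
  rw [abs_neg, ← sub_eq_add_neg] at h2
  rw [abs_of_pos hu0] at h1 h2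
  norm_num [Nat.factorial] at h1 h2
  have hu2 : 0 < u ^ 2 := by positivity
  have h3 : lam * u ^ 2 < β * u ^ 2 := by nlinarith [mul_lt_mul_of_pos_right huq hu2]
  exact lt_of_mul_lt_mul_right h3 hu2.le

end

end RFCW

/-- The magnetization is compared, value by value, with tilted product measures centred near `m`.
This only involves `G` on `[m - A, m + A]`, where `m` is the unique minimum, so that the condition
on height and broadness is not needed once `A` is small. -/
theorem mainTheorem1 (ν : Measure ℝ) [IsProbabilityMeasure ν] (β : ℝ) (hβ : 0 < β)
    (hν : Integrable (fun y : ℝ => y ^ 2) ν)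
    (m : ℝ) (k : ℕ) (lam : ℝ) (hm : RFCW.IsMinimumOfType (RFCW.G β ν) m k lam)
    (hcond : ENNReal.ofReal (2 * RFCW.height (RFCW.G β ν) m) / RFCW.broadness (RFCW.G β ν) m ^ 2
      < ENNReal.ofReal β) :
    ∃ A : ℝ, 0 < A ∧ ∀ᵐ h ∂(RFCW.fieldLaw ν), ∀ a : ℝ, 0 < a → a < A →
      ∀ α : ℝ, 1 - 1 / (2 * (2 * (k : ℝ) - 1)) < α → α < 1 →
        RFCW.SatisfiesLDP (RFCW.conditionedLaw β h m a α)
          (fun n => (n : ℝ) ^ (1 - 2 * (k : ℝ) * (1 - α)))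
          (fun x => ((RFCW.rateFunction k lam β x : ℝ) : EReal)) := by
  obtain ⟨A, hA, hA1, hexp, hlow⟩ := hm.exists_radius
  obtain ⟨K, -, hK⟩ := RFCW.ae_eventually_increment_close hβ hν m
  have hlam := hm.strength_pos
  have hκ : 0 < lam / (2 * k).factorial := div_pos hlam (by positivity)
  refine ⟨A, hA, ?_⟩
  filter_upwards [hK] with h hh a ha haA α hα hα1
  have hs : RFCW.ModerateScale k α := ⟨hm.one_le, hα, hα1⟩
  change RFCW.SatisfiesLDP (RFCW.conditionedLaw β h m a α) (RFCW.speed k α) _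
  rcases hm.one_le.eq_or_lt with rfl | hk
  · have hlt : lam < β := hm.strength_lt hβ hν
    have hsub : 0 < β - lam := sub_pos.mpr hlt
    have hf : lam / ((2 * 1).factorial : ℝ) = lam / 2 := by norm_num [Nat.factorial]
    -- With 2κ₁ = λ, stationarity reads β(1 - c) + λc = 0, hence c = β/(β - λ).
    have H : RFCW.QuenchedExpansion β m (lam / (2 * 1).factorial) (lam / (2 * 1).factorial)
        (β / (β - lam)) A 1 h (RFCW.G β ν) :=
      { beta_pos := hβ, coeff_pos := hκ, radius_pos := hA, radius_le := hA1
        quadratic := Or.inl ⟨rfl, rfl⟩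
        tilt_factor := by rw [hf]; field_simp; ring
        expansion := hexp, lower := hlow, close := ⟨K, hh⟩ }
    have hσ : lam⁻¹ - β⁻¹ = (β - lam) / (lam * β) := by field_simp
    refine H.satisfiesLDP hs ha haA.le (w := (2 * (lam⁻¹ - β⁻¹))⁻¹) ?_ ?_ ?_
    · rw [hσ]; positivity
    · intro x
      rw [RFCW.rateFunction, if_pos rfl, mul_one, div_eq_inv_mul]
    · intro z
      rw [RFCW.rateFunction, if_pos rfl, hσ, hf, mul_one]
      field_simp
      ring
  · have H : RFCW.QuenchedExpansion β m (lam / (2 * k).factorial) 0 1 A k h (RFCW.G β ν) :=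
      { beta_pos := hβ, coeff_pos := hκ, radius_pos := hA, radius_le := hA1
        quadratic := Or.inr ⟨hk, rfl⟩
        tilt_factor := by ring
        expansion := hexp, lower := hlow, close := ⟨K, hh⟩ }
    have hI : ∀ x, RFCW.rateFunction k lam β x = lam / (2 * k).factorial * x ^ (2 * k) := by
      intro x
      rw [RFCW.rateFunction, if_neg (by omega)]
      ring
    refine H.satisfiesLDP hs ha haA.le hκ hI fun z => ?_
    rw [hI]
    ring
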